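/- A network consists of finitely many sources $S_i$ and parties $A_j$; write $i\to j$ when $S_i$ is connected to $A_j$. It is an Exclusive Common-Source (ECS) network if for every source $S_i$ there are parties $A_j\neq A_{j'}$ such that $S_i$ is the only source connected to both. It admits a Perfect Fractional Independent Set (PFIS) if there are weights $0<x_j<1$ with $\sum_{j:\,i\to j}x_j=1$ for every $S_i$. A classical strategy: each $S_i$ independently takes a value $s_i$ in a set $\mathcal S_i$ with a discrete probability distribution, and each $A_j$ outputs $a_j$ with probability $P(a_j\,|\,\{s_i:i\to j\})$, giving the distribution $P(a)=\sum_{s}\prod_i p(s_i)\prod_j P(a_j|\{s_i:i\to j\})$. A quantum strategy: each arrow $i\to j$ carries a finite-dimensional Hilbert space with a computational basis, $S_i$ distributes a pure state $|\psi_i\rangle$ of the tensor product of the spaces of its arrows, $A_j$ performs a projective measurement $\{\Pi_{a_j}\}$ on the tensor product of the spaces of hers, and $P(a)=\mathrm{Tr}\big(\bigotimes_i|\psi_i\rangle\langle\psi_i|\cdot\bigotimes_j\Pi_{a_j}\big)$. A quantum Color-Matching (CM) strategy with colors $\{1,\dots,C\}$ and color distribution $p_{\mathrm{color}}(c)>0$,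 $\sum_c p_{\mathrm{color}}(c)=1$: each computational basis vector of an arrow has a color (and possibly carries additional information); $|\psi_i\rangle$ is a superposition of product basis vectors in which all arrows have the same color, the total weight of color $c$ being $p_{\mathrm{color}}(c)$; and the measurement of each $A_j$ includes, for each $c$, the projection ("color match $c$") onto the span of the product basis vectors all of whose components have color $c$. For colors $\{c_i:i\to j\}$, the vector $|c_i:i\to j\rangle$ belongs to the measurement basis of $A_j$ if the projection onto the span of the product basis vectors whose component from $S_i$ has color $c_i$ for every $i\to j$ is one of her measurement projections (it is the rank-one projection onto $|c_i:i\to j\rangle$ if there is no additional information). A classical strategy that simulates (has the same output distribution as) such a quantum strategy is CM if there are functions assigning to each value $s_i$ a color taken by $S_i$ such that each $S_i$ takes color $c$ with probability $p_{\mathrm{color}}(c)$, and each $A_j$ outputs color match $c$ if and only if all sources connected to her take color $c$ (for all source values of positive probability). The vector $|c_i:i\to j\rangle$ is rigid for $A_j$ if it belongs to the measurement basis of $A_j$ and, in every simulating classical strategy and for all such color functions, $A_j$ outputs it if and only if every $S_i$ with $i\to j$ takes color $c_i$. Corollary. Consider a quantum CM strategy in an ECS network admitting a PFIS. Every classical strategy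 that simulates it is CM, with the same $p_{\mathrm{color}}$. Moreover: Main statement (iii). Fix a color $c_i$ for every source $S_i$. If for every party $A_j$ the vector $|c_i:i\to j\rangle$ belongs to the measurement basis of $A_j$, then $|c_i:i\to j\rangle$ is rigid for $A_j$, for every $j$. (i) Suppose that $|c_i:i\to j\rangle$ belongs to the measurement basis of $A_j$, and that for every source $S_i$ connected to $A_j$ there is a party $A_{j^{(i)}}$ connected to $S_i$ such that $S_i$ is the unique common source of $A_j$ and $A_{j^{(i)}}$. Then $|c_i:i\to j\rangle$ is rigid for $A_j$. (ii) Suppose that $|c_i:i\to j\rangle$ belongs to the measurement basis of $A_j$, and let $A_{j_1},\dots,A_{j_k}$ be parties different from $A_j$ such that every source connected to $A_j$ is connected to some $A_{j_\ell}$. Suppose that $\{c_i:i\to j\}$ is extended to an assignment of colors $c_{i'}$ to all sources connected to $A_{j_1},\dots,A_{j_k}$ such that for every $\ell$ the vector $|c_{i'}:i'\to j_\ell\rangle$ is rigid for $A_{j_\ell}$. Then $|c_i:i\to j\rangle$ is rigid for $A_j$. -/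

import Mathlib

/-- A network: a bipartite graph between sources `i : I` and parties `j : J`;
`N.conn i j` means that the source `i` is connected to the party `j`. -/
structure Network (I J : Type*) where
  conn : I → J → Prop

namespace Network

variable {I J : Type*}

/-- The parties connected to the source `i`. -/
abbrev PartyOf (N : Network I J) (i : I) : Type _ := {j : J // N.conn i j}

/-- The sources connected to the party `j`. -/
abbrev SourceOf (N : Network I J) (j : J) : Type _ := {i : I // N.conn i j}

/-- Exclusive Common-Source network: every source is the only common source of two distinct
parties. -/
def IsECS (N : Network I J) : Prop :=
  ∀ i, ∃ j j', j ≠ j' ∧ N.conn i j ∧ N.conn i j' ∧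
    ∀ i', N.conn i' j → N.conn i' j' → i' = i

open Classical in
/-- The network admits a Perfect Fractional Independent Set. -/
def AdmitsPFIS [Fintype J] (N : Network I J) : Prop :=
  ∃ x : J → ℝ, (∀ j, 0 < x j ∧ x j < 1) ∧ ∀ i, ∑ j with N.conn i j, x j = 1

/-- The restriction to the sources connected to `j` of an assignment to all sources. -/
def restrict (N : Network I J) {X : Type*} (c : I → X) (j : J) : N.SourceOf j → X :=
  fun i => c i

end Network

/-- A classical strategy: each source `i` draws a value in `S i` with the (discrete) distribution
`src i`, and each party `j` outputs `a` with probability `resp j s a`, given the values `s` of the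
sources connected to her. -/
structure ClassicalStrategy {I J : Type*} (N : Network I J) (Out : J → Type*) where
  S : I → Type
  src : ∀ i, PMF (S i)
  resp : ∀ j, (∀ i : N.SourceOf j, S i) → PMF (Out j)

namespace ClassicalStrategy

variable {I J : Type*} [Fintype I] [Fintype J] {N : Network I J} {Out : J → Type*}

/-- The joint distribution of the outputs of a classical strategy. -/
noncomputable def prob (σ : ClassicalStrategy N Out) (a : ∀ j, Out j) : ENNReal :=
  ∑' s : (∀ i, σ.S i), (∏ i, σ.src i (s i)) * ∏ j, σ.resp j (fun i => s i) (a j)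

/-- The party `j` outputs `a` if and only if `E` holds for the values received from her sources:
for all values that the sources take with positive probability, she outputs `a` with
certainty if `E` holds, and never otherwise. -/
def OutputsIff (σ : ClassicalStrategy N Out) (j : J) (a : Out j)
    (E : (∀ i : N.SourceOf j, σ.S i) → Prop) : Prop :=
  ∀ s : (∀ i : N.SourceOf j, σ.S i), (∀ i : N.SourceOf j, s i ∈ (σ.src i).support) →
    (E s → σ.resp j s a = 1) ∧ (¬ E s → σ.resp j s a = 0)

end ClassicalStrategy

open Classical in
/-- A quantum strategy. The arrow from `i` to `j` carries the Hilbert space with computational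
basis `κ i j`. The source `i` distributes the pure state `state i` of the tensor product of the
Hilbert spaces of its arrows (a unit vector, given by its coordinates), and the party `j` performs
the projective measurement `(meas j a)ₐ` on the tensor product of the Hilbert spaces of hers. -/
structure QuantumStrategy {I J : Type*} [Fintype I] [Fintype J] (N : Network I J)
    (Out : J → Type*) [∀ j, Fintype (Out j)] (κ : I → J → Type*) [∀ i j, Fintype (κ i j)] where
  state : ∀ i, (∀ j : N.PartyOf i, κ i j) → ℂ
  state_norm : ∀ i, ∑ w, ‖state i w‖ ^ 2 = 1
  meas : ∀ j, Out j → Matrix (∀ i : N.SourceOf j, κ i j) (∀ i : N.SourceOf j, κ i j) ℂ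
  meas_hermitian : ∀ j a, (meas j a).IsHermitian
  meas_idem : ∀ j a, meas j a * meas j a = meas j a
  meas_sum : ∀ j, ∑ a, meas j a = 1

namespace QuantumStrategy

variable {I J : Type*} [Fintype I] [Fintype J] {N : Network I J}
  {Out : J → Type*} [∀ j, Fintype (Out j)] {κ : I → J → Type*} [∀ i j, Fintype (κ i j)]

/-- The computational basis of the tensor product of the Hilbert spaces of all arrows. -/
abbrev GlobalIndex (N : Network I J) (κ : I → J → Type*) : Type _ :=
  ∀ i, ∀ j : N.PartyOf i, κ i j

/-- The part of a global basis label held by the party `j`. -/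
def view (w : GlobalIndex N κ) (j : J) : ∀ i : N.SourceOf j, κ i j :=
  fun i => w i ⟨j, i.2⟩

/-- The tensor product of the states of all sources. -/
def globalState (Q : QuantumStrategy N Out κ) : GlobalIndex N κ → ℂ :=
  fun w => ∏ i, Q.state i (w i)

/-- The tensor product of the measurement projections of all parties. -/
def globalMeas (Q : QuantumStrategy N Out κ) (a : ∀ j, Out j) :
    Matrix (GlobalIndex N κ) (GlobalIndex N κ) ℂ :=
  Matrix.of fun w w' => ∏ j, Q.meas j (a j) (view w j) (view w' j)

open Classical in
/-- The joint distribution of the outputs: the trace of the product of the global density matrix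
with the tensor product of the measurement projections (a nonnegative real number). -/
noncomputable def prob (Q : QuantumStrategy N Out κ) (a : ∀ j, Out j) : ℝ :=
  (Matrix.vecMulVec Q.globalState (star Q.globalState) * Q.globalMeas a).trace.re

/-- The projection of the Hilbert space of the party `j` onto the span of the computational basis
vectors whose component from each source `i` has the color `c i`, where `color i j k` is the color
of the basis vector `k` of the arrow from `i` to `j`. If the basis vectors of the arrows are the
colors themselves (`κ i j = Fin C` and `color i j k = k`), this is the rank-one projection onto
the computational basis vector `|c_i : i → j⟩`. -/
noncomputable def colorProj (N : Network I J) {C : ℕ} (color : ∀ i j, κ i j → Fin C) (j : J)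
    (c : N.SourceOf j → Fin C) :
    Matrix (∀ i : N.SourceOf j, κ i j) (∀ i : N.SourceOf j, κ i j) ℂ :=
  open Classical in Matrix.diagonal fun v => if ∀ i : N.SourceOf j, color i j (v i) = c i then 1 else 0

open Classical in
/-- The structure of a Color-Matching strategy, with colors in `Fin C`, on a quantum strategy.
Each computational basis vector of an arrow carries a color (and possibly additional
information); each source distributes a superposition of basis vectors for which all the parties
connected to it receive the same color, this color being `c` with weight `pcolor c`; the
measurement of each party includes, for each color `c`, the projection of the color match `c`,
with the outcome `matchOut j c`. -/
structure ColorMatching (Q : QuantumStrategy N Out κ) (C : ℕ) where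
  color : ∀ i j, κ i j → Fin C
  pcolor : Fin C → ℝ
  pcolor_pos : ∀ c, 0 < pcolor c
  pcolor_sum : ∑ c, pcolor c = 1
  same_color : ∀ i w, Q.state i w ≠ 0 → ∃ c, ∀ j : N.PartyOf i, color i j (w j) = c
  color_weight : ∀ i c,
    ∑ w with (∀ j : N.PartyOf i, color i j (w j) = c), ‖Q.state i w‖ ^ 2 = pcolor c
  matchOut : ∀ j, Fin C → Out j
  meas_matchOut : ∀ j c, Q.meas j (matchOut j c) = colorProj N color j (fun _ => c)

/-- The classical strategy `σ` simulates the output distribution of the quantum strategy `Q`. -/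
def SimulatedBy (Q : QuantumStrategy N Out κ) (σ : ClassicalStrategy N Out) : Prop :=
  ∀ a, σ.prob a = ENNReal.ofReal (Q.prob a)

namespace ColorMatching

variable {Q : QuantumStrategy N Out κ} {C : ℕ}

/-- The outcome `a` of the party `j` is the one of the computational basis vector
`|c_i : i → j⟩`. -/
def IsOutcome (M : Q.ColorMatching C) (j : J) (c : N.SourceOf j → Fin C) (a : Out j) : Prop :=
  Q.meas j a = colorProj N M.color j c

/-- The computational basis vector `|c_i : i → j⟩` belongs to the measurement basis of the
party `j`. -/
def InBasis (M : Q.ColorMatching C) (j : J) (c : N.SourceOf j → Fin C) : Prop :=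
  ∃ a, M.IsOutcome j c a

/-- The classical strategy `σ` is a Color-Matching strategy in which the source `i` takes the
color `col i s` when its value is `s`: each source takes the color `c` with probability
`pcolor c`, and each party outputs the color match `c` if and only if all the sources connected
to her take the color `c`. -/
def IsColoring (M : Q.ColorMatching C) (σ : ClassicalStrategy N Out)
    (col : ∀ i, σ.S i → Fin C) : Prop :=
  (∀ i c, (σ.src i).map (col i) c = ENNReal.ofReal (M.pcolor c)) ∧
  ∀ j c, σ.OutputsIff j (M.matchOut j c) (fun s => ∀ i : N.SourceOf j, col i (s i) = c)

/-- The computational basis vector `|c_i : i → j⟩` is rigid for the party `j`: it belongs to her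
measurement basis, and in any classical strategy that simulates the same distribution she outputs
it if and only if every source `i` connected to her takes the color `c i`. -/
def IsRigid (M : Q.ColorMatching C) (j : J) (c : N.SourceOf j → Fin C) : Prop :=
  M.InBasis j c ∧
  ∀ σ : ClassicalStrategy N Out, Q.SimulatedBy σ →
    ∀ col : (∀ i, σ.S i → Fin C), M.IsColoring σ col →
      ∀ a, M.IsOutcome j c a → σ.OutputsIff j a (fun s => ∀ i : N.SourceOf j, col i (s i) = c i)

end ColorMatching

end QuantumStrategy

open Function

section ProductExpectation

variable {I : Type*} {S : I → Type*} {p : ∀ i, PMF (S i)}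

theorem exists_mem_support (p : ∀ i, PMF (S i)) : ∃ s : ∀ i, S i, ∀ i, p i (s i) ≠ 0 := by
  choose s hs using fun i => (p i).support_nonempty
  exact ⟨s, hs⟩

open Classical in
/-- The average of `f` over the coordinate `i`, the other coordinates being fixed. -/
noncomputable def coordAvg (p : ∀ i, PMF (S i)) (i : I) (f : (∀ i, S i) → ENNReal) :
    (∀ i, S i) → ENNReal :=
  fun s => ∑' t, p i t * f (update s i t)

theorem coordAvg_of_dependsOn {i : I} {f : (∀ i, S i) → ENNReal} {B : Set I} (hf : DependsOn f B)
    (hi : i ∉ B) : coordAvg p i f = f := by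
  classical
  ext s
  have : ∀ t, f (update s i t) = f s := fun t => hf fun k hk => by
    rw [update_of_ne (fun h : k = i => hi (h ▸ hk))]
  rw [coordAvg]
  simp_rw [this]
  rw [ENNReal.tsum_mul_right, PMF.tsum_coe, one_mul]

theorem coordAvg_dependsOn {i : I} {f : (∀ i, S i) → ENNReal} {B : Set I} (hf : DependsOn f B) :
    DependsOn (coordAvg p i f) (B \ {i}) := by
  classical
  intro s s' h
  refine tsum_congr fun t => ?_
  congr 1
  refine hf fun k hk => ?_
  by_cases hki : k = i
  · subst hki; simp
  · simp [update_of_ne hki, h k ⟨hk, hki⟩]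

theorem coordAvg_le_one {i : I} {f : (∀ i, S i) → ENNReal} (h : ∀ s, f s ≤ 1) (s : ∀ i, S i) :
    coordAvg p i f s ≤ 1 := by
  classical
  calc coordAvg p i f s ≤ ∑' t, p i t * 1 := ENNReal.tsum_le_tsum fun t => by gcongr; exact h _
    _ = 1 := by simp [PMF.tsum_coe]

variable [Fintype I]

theorem ENNReal.tsum_pi_prod (g : ∀ i, S i → ENNReal) :
    ∑' s : (∀ i, S i), ∏ i, g i (s i) = ∏ i, ∑' t, g i t := by
  classical
  suffices H : ∀ (n : ℕ) {S : Fin n → Type _} (g : ∀ i, S i → ENNReal),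
      ∑' s : (∀ i, S i), ∏ i, g i (s i) = ∏ i, ∑' t, g i t by
    let e := (Fintype.equivFin I).symm
    have h := H _ (fun k => g (e k))
    rw [Equiv.prod_comp e (fun i => ∑' t, g i t)] at h
    rw [← h, ← (Equiv.piCongrLeft S e).tsum_eq]
    refine tsum_congr fun s => ?_
    rw [← Equiv.prod_comp e]
    simp
  intro n
  induction n with
  | zero => intro S g; simp [tsum_fintype]
  | succ n ih =>
    intro S g
    rw [← (Fin.consEquiv S).tsum_eq, ENNReal.tsum_prod', Fin.prod_univ_succ, ← ih,
      ← ENNReal.tsum_mul_right]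
    refine tsum_congr fun t => ?_
    rw [← ENNReal.tsum_mul_left]
    refine tsum_congr fun s => ?_
    rw [Fin.prod_univ_succ]
    simp [Fin.consEquiv]

theorem ENNReal.eq_of_tsum_mul_eq {α : Type*} {w f g : α → ENNReal} (hle : ∀ a, w a ≠ 0 → f a ≤ g a)
    (hw : ∀ a, w a ≠ ⊤) (hfin : ∑' a, w a * f a ≠ ⊤)
    (h : ∑' a, w a * f a = ∑' a, w a * g a) (a : α) (ha : w a ≠ 0) : f a = g a := by
  by_contra hne
  have hlt : f a < g a := lt_of_le_of_ne (hle a ha) hne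
  refine (ENNReal.tsum_lt_tsum (i := a) hfin (fun b => ?_) ?_).ne h
  · by_cases hb : w b = 0
    · simp [hb]
    · gcongr; exact hle b hb
  · exact (ENNReal.mul_lt_mul_iff_right ha (hw a)).2 hlt

/-- The expectation of `f` under the product of the distributions `p i`. -/
noncomputable def prodExp (p : ∀ i, PMF (S i)) (f : (∀ i, S i) → ENNReal) : ENNReal :=
  ∑' s, (∏ i, p i (s i)) * f s

theorem prodExp_prod (g : ∀ i, S i → ENNReal) :
    prodExp p (fun s => ∏ i, g i (s i)) = ∏ i, ∑' t, p i t * g i t := by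
  simp_rw [prodExp, ← Finset.prod_mul_distrib]
  exact ENNReal.tsum_pi_prod fun i t => p i t * g i t

theorem prodExp_const (c : ENNReal) : prodExp p (fun _ => c) = c := by
  rw [prodExp, ENNReal.tsum_mul_right, ENNReal.tsum_pi_prod]
  simp [PMF.tsum_coe]

theorem prodWeight_ne_zero {s : ∀ i, S i} :
    ∏ i, p i (s i) ≠ 0 ↔ ∀ i, p i (s i) ≠ 0 := by
  simp [Finset.prod_ne_zero_iff]

theorem prodExp_mono {f g : (∀ i, S i) → ENNReal}
    (h : ∀ s, (∀ i, p i (s i) ≠ 0) → f s ≤ g s) : prodExp p f ≤ prodExp p g := by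
  refine ENNReal.tsum_le_tsum fun s => ?_
  by_cases hs : ∏ i, p i (s i) = 0
  · simp [hs]
  · gcongr; exact h s (prodWeight_ne_zero.1 hs)

theorem prodExp_congr {f g : (∀ i, S i) → ENNReal}
    (h : ∀ s, (∀ i, p i (s i) ≠ 0) → f s = g s) : prodExp p f = prodExp p g :=
  le_antisymm (prodExp_mono fun s hs => (h s hs).le) (prodExp_mono fun s hs => (h s hs).ge)

theorem prodExp_le_one {f : (∀ i, S i) → ENNReal} (h : ∀ s, f s ≤ 1) : prodExp p f ≤ 1 :=
  (prodExp_mono fun s _ => h s).trans (prodExp_const 1).le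

theorem eq_of_prodExp_eq {f g : (∀ i, S i) → ENNReal}
    (hle : ∀ s, (∀ i, p i (s i) ≠ 0) → f s ≤ g s) (hfin : prodExp p f ≠ ⊤)
    (h : prodExp p f = prodExp p g) (s : ∀ i, S i) (hs : ∀ i, p i (s i) ≠ 0) : f s = g s :=
  ENNReal.eq_of_tsum_mul_eq (w := fun s : (∀ i, S i) => ∏ i, p i (s i)) (f := f) (g := g)
    (fun s hs => hle s ((prodWeight_ne_zero (s := s)).1 hs))
    (fun s => ENNReal.prod_ne_top fun i _ => (p i).apply_ne_top (s i)) hfin h s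
    (prodWeight_ne_zero.2 hs)

theorem eq_zero_of_prodExp_eq_zero {f : (∀ i, S i) → ENNReal} (h : prodExp p f = 0)
    (s : ∀ i, S i) (hs : ∀ i, p i (s i) ≠ 0) : f s = 0 :=
  (mul_eq_zero.1 (ENNReal.tsum_eq_zero.1 h s)).resolve_left (prodWeight_ne_zero.2 hs)

theorem exists_ne_zero_of_prodExp_ne_zero {f : (∀ i, S i) → ENNReal} (h : prodExp p f ≠ 0) :
    ∃ s, (∀ i, p i (s i) ≠ 0) ∧ f s ≠ 0 := by
  contrapose! h
  rw [prodExp_congr (g := fun _ => 0) h, prodExp_const]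

theorem prodExp_coordAvg (i : I) (f : (∀ i, S i) → ENNReal) :
    prodExp p (coordAvg p i f) = prodExp p f := by
  classical
  let e : ((∀ i, S i) × S i) ≃ ((∀ i, S i) × S i) :=
    { toFun := fun z => (update z.1 i z.2, z.1 i)
      invFun := fun z => (update z.1 i z.2, z.1 i)
      left_inv := fun z => by simp
      right_inv := fun z => by simp }
  have hw : ∀ (s : ∀ i, S i) (t : S i),
      (∏ k, p k (s k)) * p i t = (∏ k, p k (update s i t k)) * p i (s i) := by
    intro s t
    rw [← Finset.mul_prod_erase _ _ (Finset.mem_univ i),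
      ← Finset.mul_prod_erase _ (fun k => p k (update s i t k)) (Finset.mem_univ i)]
    have h : ∏ k ∈ Finset.univ.erase i, p k (update s i t k) =
        ∏ k ∈ Finset.univ.erase i, p k (s k) :=
      Finset.prod_congr rfl fun k hk => by rw [update_of_ne (Finset.ne_of_mem_erase hk)]
    rw [h, update_self]
    ring
  calc prodExp p (coordAvg p i f)
      = ∑' z : (∀ i, S i) × S i, (∏ k, p k (z.1 k)) * p i z.2 * f (update z.1 i z.2) := by
        rw [ENNReal.tsum_prod']
        refine tsum_congr fun s => ?_
        rw [coordAvg, ← ENNReal.tsum_mul_left]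
        refine tsum_congr fun t => ?_
        rw [mul_assoc]
    _ = ∑' z : (∀ i, S i) × S i, (∏ k, p k (z.1 k)) * p i z.2 * f z.1 := by
        rw [← e.tsum_eq]
        refine tsum_congr fun z => ?_
        simp only [e, Equiv.coe_fn_mk]
        rw [← hw]
        simp
    _ = prodExp p f := by
        rw [ENNReal.tsum_prod']
        refine tsum_congr fun s => ?_
        simp only
        rw [ENNReal.tsum_mul_right, ENNReal.tsum_mul_left, PMF.tsum_coe, mul_one]

end ProductExpectation

section Holder

variable {J T : Type*}

theorem ENNReal.geom_mean_le_arith_mean_weighted {s : Finset J} {x : J → ℝ} {z : J → ENNReal}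
    (hx : ∀ j ∈ s, 0 < x j) (hx1 : ∑ j ∈ s, x j = 1) (hz : ∀ j ∈ s, z j ≠ ⊤) :
    ∏ j ∈ s, z j ^ x j ≤ ∑ j ∈ s, ENNReal.ofReal (x j) * z j := by
  have h := Real.geom_mean_le_arith_mean_weighted s x (fun j => (z j).toReal)
    (fun j hj => (hx j hj).le) hx1 (fun j _ => ENNReal.toReal_nonneg)
  have h' := ENNReal.ofReal_le_ofReal h
  rw [ENNReal.ofReal_prod_of_nonneg (fun j _ => by positivity),
    ENNReal.ofReal_sum_of_nonneg (fun j hj => mul_nonneg (hx j hj).le ENNReal.toReal_nonneg)] at h'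
  convert h' using 1
  · refine Finset.prod_congr rfl fun j hj => ?_
    rw [← ENNReal.ofReal_rpow_of_nonneg ENNReal.toReal_nonneg (hx j hj).le,
      ENNReal.ofReal_toReal (hz j hj)]
  · refine Finset.sum_congr rfl fun j hj => ?_
    rw [ENNReal.ofReal_mul (hx j hj).le, ENNReal.ofReal_toReal (hz j hj)]

theorem ENNReal.eq_of_geom_mean_eq_arith_mean_weighted {s : Finset J} {x : J → ℝ}
    {z : J → ENNReal} (hx : ∀ j ∈ s, 0 < x j) (hx1 : ∑ j ∈ s, x j = 1) (hz : ∀ j ∈ s, z j ≠ ⊤)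
    (h : ∏ j ∈ s, z j ^ x j = ∑ j ∈ s, ENNReal.ofReal (x j) * z j) :
    ∀ j ∈ s, ∀ k ∈ s, z j = z k := by
  have h' := (Real.geom_mean_eq_arith_mean_weighted_iff_of_pos s x (fun j => (z j).toReal)
    hx hx1 (fun j _ => ENNReal.toReal_nonneg)).1 (by
      have := congrArg ENNReal.toReal h
      rw [ENNReal.toReal_prod, ENNReal.toReal_sum
        (fun j hj => ENNReal.mul_ne_top ENNReal.ofReal_ne_top (hz j hj))] at this
      convert this using 1
      · exact Finset.prod_congr rfl fun j _ => ENNReal.toReal_rpow _ _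
      · refine Finset.sum_congr rfl fun j hj => ?_
        rw [ENNReal.toReal_mul, ENNReal.toReal_ofReal (hx j hj).le])
  exact fun j hj k hk => (ENNReal.toReal_eq_toReal_iff' (hz j hj) (hz k hk)).1 (h' j hj k hk)

variable {p : PMF T} {s : Finset J} {x : J → ℝ} {f : J → T → ENNReal}

theorem PMF.tsum_mul_ne_top {g : T → ENNReal} (hg : ∀ t, g t ≤ 1) : ∑' t, p t * g t ≠ ⊤ := by
  refine ne_top_of_le_ne_top ENNReal.one_ne_top (b := 1) ?_
  calc ∑' t, p t * g t ≤ ∑' t, p t * 1 := ENNReal.tsum_le_tsum fun t => by gcongr; exact hg t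
    _ = 1 := by simp [PMF.tsum_coe]

theorem PMF.tsum_arith_mean_eq_one (hx : ∀ j ∈ s, 0 < x j) (hx1 : ∑ j ∈ s, x j = 1)
    (hf : ∀ j t, f j t ≤ 1) (h0 : ∀ j ∈ s, ∑' t, p t * f j t ≠ 0) :
    ∑' t, p t * ∑ j ∈ s, ENNReal.ofReal (x j) * (f j t / ∑' u, p u * f j u) = 1 := by
  simp_rw [Finset.mul_sum]
  rw [Summable.tsum_finsetSum fun j _ => ENNReal.summable]
  rw [← ENNReal.ofReal_one, ← hx1, ENNReal.ofReal_sum_of_nonneg fun j hj => (hx j hj).le]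
  refine Finset.sum_congr rfl fun j hj => ?_
  calc ∑' t, p t * (ENNReal.ofReal (x j) * (f j t / ∑' u, p u * f j u))
      = ∑' t, ENNReal.ofReal (x j) * ((p t * f j t) * (∑' u, p u * f j u)⁻¹) := by
        refine tsum_congr fun t => ?_
        rw [div_eq_mul_inv]; ring
    _ = ENNReal.ofReal (x j) := by
        rw [ENNReal.tsum_mul_left, ENNReal.tsum_mul_right,
          ENNReal.mul_inv_cancel (h0 j hj) (PMF.tsum_mul_ne_top (hf j)), mul_one]

theorem PMF.prod_rpow_eq (hx : ∀ j ∈ s, 0 < x j) (hf : ∀ j t, f j t ≤ 1)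
    (h0 : ∀ j ∈ s, ∑' t, p t * f j t ≠ 0) (t : T) :
    ∏ j ∈ s, f j t ^ x j =
      (∏ j ∈ s, (∑' u, p u * f j u) ^ x j) * ∏ j ∈ s, (f j t / ∑' u, p u * f j u) ^ x j := by
  rw [← Finset.prod_mul_distrib]
  refine Finset.prod_congr rfl fun j hj => ?_
  rw [← ENNReal.mul_rpow_of_nonneg _ _ (hx j hj).le,
    ENNReal.mul_div_cancel (h0 j hj) (PMF.tsum_mul_ne_top (hf j))]

theorem PMF.div_tsum_ne_top (hf : ∀ j t, f j t ≤ 1)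
    (h0 : ∀ j ∈ s, ∑' t, p t * f j t ≠ 0) (t : T) :
    ∀ j ∈ s, f j t / (∑' u, p u * f j u) ≠ ⊤ := fun j hj =>
  ENNReal.div_ne_top (ne_top_of_le_ne_top ENNReal.one_ne_top (hf j t)) (h0 j hj)

/-- Hölder's inequality with weights, for functions with values in `[0, 1]`. -/
theorem PMF.tsum_prod_rpow_le (hx : ∀ j ∈ s, 0 < x j) (hx1 : ∑ j ∈ s, x j = 1)
    (hf : ∀ j t, f j t ≤ 1) :
    ∑' t, p t * ∏ j ∈ s, f j t ^ x j ≤ ∏ j ∈ s, (∑' t, p t * f j t) ^ x j := by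
  by_cases h0 : ∀ j ∈ s, ∑' t, p t * f j t ≠ 0
  · calc ∑' t, p t * ∏ j ∈ s, f j t ^ x j
        = (∏ j ∈ s, (∑' u, p u * f j u) ^ x j) *
          ∑' t, p t * ∏ j ∈ s, (f j t / ∑' u, p u * f j u) ^ x j := by
          rw [← ENNReal.tsum_mul_left]
          refine tsum_congr fun t => ?_
          rw [PMF.prod_rpow_eq hx hf h0, mul_left_comm]
      _ ≤ (∏ j ∈ s, (∑' u, p u * f j u) ^ x j) *
          ∑' t, p t * ∑ j ∈ s, ENNReal.ofReal (x j) * (f j t / ∑' u, p u * f j u) := by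
          gcongr with t
          exact ENNReal.geom_mean_le_arith_mean_weighted hx hx1 (PMF.div_tsum_ne_top hf h0 t)
      _ = _ := by rw [PMF.tsum_arith_mean_eq_one hx hx1 hf h0, mul_one]
  · push Not at h0
    obtain ⟨j, hj, h0⟩ := h0
    refine le_of_eq_of_le (ENNReal.tsum_eq_zero.2 fun t => ?_) (zero_le)
    rcases mul_eq_zero.1 (ENNReal.tsum_eq_zero.1 h0 t) with h | h
    · simp [h]
    · rw [Finset.prod_eq_zero hj (by rw [h, ENNReal.zero_rpow_of_pos (hx j hj)]), mul_zero]

/-- The case of equality in Hölder's inequality: the functions are proportional. -/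
theorem PMF.div_eq_div_of_tsum_prod_rpow_eq (hx : ∀ j ∈ s, 0 < x j) (hx1 : ∑ j ∈ s, x j = 1)
    (hf : ∀ j t, f j t ≤ 1) (h0 : ∀ j ∈ s, ∑' t, p t * f j t ≠ 0)
    (h : ∑' t, p t * ∏ j ∈ s, f j t ^ x j = ∏ j ∈ s, (∑' t, p t * f j t) ^ x j)
    (t : T) (ht : p t ≠ 0) :
    ∀ j ∈ s, ∀ k ∈ s, f j t / (∑' u, p u * f j u) = f k t / (∑' u, p u * f k u) := by
  have hP0 : ∏ j ∈ s, (∑' u, p u * f j u) ^ x j ≠ 0 := Finset.prod_ne_zero_iff.2 fun j hj => by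
    rw [Ne, ENNReal.rpow_eq_zero_iff_of_pos (hx j hj)]; exact h0 j hj
  have hPT : ∏ j ∈ s, (∑' u, p u * f j u) ^ x j ≠ ⊤ := ENNReal.prod_ne_top fun j hj =>
    ENNReal.rpow_ne_top_of_nonneg (hx j hj).le (PMF.tsum_mul_ne_top (hf j))
  have h1 : ∑' t, p t * ∏ j ∈ s, (f j t / ∑' u, p u * f j u) ^ x j = 1 := by
    refine (ENNReal.mul_right_inj hP0 hPT).1 ?_
    rw [mul_one, ← h, ← ENNReal.tsum_mul_left]
    conv_rhs => rw [h]
    conv_rhs => rw [← h]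
    refine tsum_congr fun t => ?_
    rw [PMF.prod_rpow_eq hx hf h0 t, mul_left_comm, h]
  refine ENNReal.eq_of_geom_mean_eq_arith_mean_weighted hx hx1 (PMF.div_tsum_ne_top hf h0 t) ?_
  exact ENNReal.eq_of_tsum_mul_eq
    (f := fun t => ∏ j ∈ s, (f j t / ∑' u, p u * f j u) ^ x j)
    (g := fun t => ∑ j ∈ s, ENNReal.ofReal (x j) * (f j t / ∑' u, p u * f j u))
    (fun t _ => ENNReal.geom_mean_le_arith_mean_weighted hx hx1 (PMF.div_tsum_ne_top hf h0 t))
    (fun t => p.apply_ne_top t) (by rw [h1]; exact ENNReal.one_ne_top)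
    (by rw [h1, PMF.tsum_arith_mean_eq_one hx hx1 hf h0]) t ht

end Holder

section Finner

variable {I J : Type*} {S : I → Type*} {p : ∀ i, PMF (S i)}
  {N : Network I J} {x : J → ℝ} {f : J → (∀ i, S i) → ENNReal}

theorem dependsOn_update_eq {g : (∀ i, S i) → ENNReal} {B : Set I} [DecidableEq I]
    (hg : DependsOn g B) {i : I} (hi : i ∉ B) (s : ∀ i, S i) (t : S i) :
    g (update s i t) = g s :=
  hg fun k hk => by rw [update_of_ne (fun h : k = i => hi (h ▸ hk))]

theorem dependsOn_coordAvg_of_insert [DecidableEq I] {A : Finset I} {i : I}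
    (hdep : ∀ j, DependsOn (f j) {k | k ∈ insert i A ∧ N.conn k j}) (j : J) :
    DependsOn (coordAvg p i (f j)) {k | k ∈ A ∧ N.conn k j} :=
  (coordAvg_dependsOn (hdep j)).mono fun _ hk =>
    ⟨(Finset.mem_insert.1 hk.1.1).resolve_left hk.2, hk.1.2⟩

variable [Fintype J]

open Classical in
theorem coordAvg_prod_rpow_eq {i : I}
    (hi : ∀ j, ¬ N.conn i j → ∀ s t, f j (update s i t) = f j s) (s : ∀ i, S i) :
    coordAvg p i (fun s => ∏ j, f j s ^ x j) s =
      (∑' t, p i t * ∏ j with N.conn i j, f j (update s i t) ^ x j) *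
        ∏ j with ¬ N.conn i j, f j s ^ x j := by
  rw [← ENNReal.tsum_mul_right]
  refine tsum_congr fun t => ?_
  beta_reduce
  rw [← Finset.prod_filter_mul_prod_filter_not Finset.univ (fun j => N.conn i j), mul_assoc]
  congr 2
  exact Finset.prod_congr rfl fun j hj => by rw [hi j (Finset.mem_filter.1 hj).2]

open Classical in
theorem prod_coordAvg_rpow_eq {i : I}
    (hi : ∀ j, ¬ N.conn i j → ∀ s t, f j (update s i t) = f j s) (s : ∀ i, S i) :
    ∏ j, coordAvg p i (f j) s ^ x j =
      (∏ j with N.conn i j, (∑' t, p i t * f j (update s i t)) ^ x j) *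
        ∏ j with ¬ N.conn i j, f j s ^ x j := by
  rw [← Finset.prod_filter_mul_prod_filter_not Finset.univ (fun j => N.conn i j)]
  congr 1
  refine Finset.prod_congr rfl fun j hj => ?_
  rw [coordAvg]
  simp_rw [hi j (Finset.mem_filter.1 hj).2]
  rw [ENNReal.tsum_mul_right, PMF.tsum_coe, one_mul]

open Classical in
theorem coordAvg_prod_rpow_le (hx : ∀ j, 0 < x j) {i : I} (hx1 : ∑ j with N.conn i j, x j = 1)
    (hf : ∀ j s, f j s ≤ 1)
    (hi : ∀ j, ¬ N.conn i j → ∀ s t, f j (update s i t) = f j s) (s : ∀ i, S i) :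
    coordAvg p i (fun s => ∏ j, f j s ^ x j) s ≤ ∏ j, coordAvg p i (f j) s ^ x j := by
  rw [coordAvg_prod_rpow_eq hi, prod_coordAvg_rpow_eq hi]
  gcongr
  exact PMF.tsum_prod_rpow_le (f := fun j t => f j (update s i t)) (fun j _ => hx j) hx1
    fun j t => hf j _

open Classical in
theorem div_coordAvg_eq (hx : ∀ j, 0 < x j) {i : I} (hx1 : ∑ j with N.conn i j, x j = 1)
    (hf : ∀ j s, f j s ≤ 1)
    (hi : ∀ j, ¬ N.conn i j → ∀ s t, f j (update s i t) = f j s) {s : ∀ i, S i}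
    (h0 : ∀ j, coordAvg p i (f j) s ≠ 0)
    (h : coordAvg p i (fun s => ∏ j, f j s ^ x j) s = ∏ j, coordAvg p i (f j) s ^ x j)
    {t : S i} (ht : p i t ≠ 0) {j k : J} (hj : N.conn i j) (hk : N.conn i k) :
    f j (update s i t) / coordAvg p i (f j) s = f k (update s i t) / coordAvg p i (f k) s := by
  rw [coordAvg_prod_rpow_eq hi, prod_coordAvg_rpow_eq hi] at h
  have h0' : ∏ j with ¬ N.conn i j, f j s ^ x j ≠ 0 := by
    refine Finset.prod_ne_zero_iff.2 fun j hj => ?_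
    rw [Ne, ENNReal.rpow_eq_zero_iff_of_pos (hx j)]
    intro h
    apply h0 j
    rw [coordAvg]
    simp [hi j (Finset.mem_filter.1 hj).2, h]
  have hT' : ∏ j with ¬ N.conn i j, f j s ^ x j ≠ ⊤ := ENNReal.prod_ne_top fun j _ =>
    ENNReal.rpow_ne_top_of_nonneg (hx j).le (ne_top_of_le_ne_top ENNReal.one_ne_top (hf j s))
  exact PMF.div_eq_div_of_tsum_prod_rpow_eq (f := fun j t => f j (update s i t))
    (fun j _ => hx j) hx1 (fun j t => hf j _) (fun j _ => h0 j)
    ((ENNReal.mul_left_inj h0' hT').1 h) t ht j (by simpa using hj) k (by simpa using hk)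

variable [Fintype I]

open Classical in
/-- **Finner's inequality** for functions with values in `[0, 1]`. -/
theorem prodExp_prod_rpow_le_of_dependsOn (hx : ∀ j, 0 < x j)
    (hx1 : ∀ i, ∑ j with N.conn i j, x j = 1) (A : Finset I)
    (f : J → (∀ i, S i) → ENNReal) (hf : ∀ j s, f j s ≤ 1)
    (hdep : ∀ j, DependsOn (f j) {i | i ∈ A ∧ N.conn i j}) :
    prodExp p (fun s => ∏ j, f j s ^ x j) ≤ ∏ j, prodExp p (f j) ^ x j := by
  induction A using Finset.induction_on generalizing f with
  | empty =>
    obtain ⟨s₀, -⟩ := exists_mem_support p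
    have hc : ∀ j, f j = fun _ => f j s₀ := fun j => funext fun s => hdep j (by simp)
    have hc' : (fun s => ∏ j, f j s ^ x j) = fun _ => ∏ j, f j s₀ ^ x j :=
      funext fun s => Finset.prod_congr rfl fun j _ => by rw [hc j]
    rw [hc', prodExp_const]
    refine Finset.prod_le_prod' fun j _ => ?_
    rw [hc j, prodExp_const]
  | insert i A hi ih =>
    calc prodExp p (fun s => ∏ j, f j s ^ x j)
        = prodExp p (coordAvg p i (fun s => ∏ j, f j s ^ x j)) := (prodExp_coordAvg i _).symm
      _ ≤ prodExp p (fun s => ∏ j, coordAvg p i (f j) s ^ x j) :=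
        prodExp_mono fun s _ => coordAvg_prod_rpow_le hx (hx1 i) hf
          (fun j hj s t => dependsOn_update_eq (hdep j) (fun h => hj h.2) s t) s
      _ ≤ ∏ j, prodExp p (coordAvg p i (f j)) ^ x j :=
        ih _ (fun j => coordAvg_le_one (hf j)) (dependsOn_coordAvg_of_insert hdep)
      _ = _ := by simp_rw [prodExp_coordAvg]

open Classical in
/-- The case of equality in Finner's inequality, for functions with values in `[0, 1]` on an
Exclusive Common-Source network: the functions are products of functions of one source. -/
theorem exists_eq_prod_of_prodExp_prod_rpow_eq (hN : N.IsECS) (hx : ∀ j, 0 < x j)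
    (hx1 : ∀ i, ∑ j with N.conn i j, x j = 1) (A : Finset I)
    (f : J → (∀ i, S i) → ENNReal) (hf : ∀ j s, f j s ≤ 1)
    (hdep : ∀ j, DependsOn (f j) {i | i ∈ A ∧ N.conn i j})
    (h0 : ∀ j, prodExp p (f j) ≠ 0)
    (h : prodExp p (fun s => ∏ j, f j s ^ x j) = ∏ j, prodExp p (f j) ^ x j) :
    ∃ g : ∀ i, S i → ENNReal, ∀ j s, (∀ i, p i (s i) ≠ 0) →
      f j s = prodExp p (f j) * ∏ i ∈ A with N.conn i j, g i (s i) := by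
  induction A using Finset.induction_on generalizing f with
  | empty =>
    refine ⟨fun _ _ => 1, fun j s _ => ?_⟩
    have hc : f j = fun _ => f j s := funext fun s' => hdep j (by simp)
    rw [hc, prodExp_const]
    simp
  | insert i A hi ih =>
    have hupd : ∀ j, ¬ N.conn i j → ∀ s t, f j (update s i t) = f j s :=
      fun j hj s t => dependsOn_update_eq (hdep j) (fun h => hj h.2) s t
    set F : J → (∀ i, S i) → ENNReal := fun j => coordAvg p i (f j) with hF
    have hF1 : ∀ j s, F j s ≤ 1 := fun j => coordAvg_le_one (hf j)
    have hFdep : ∀ j, DependsOn (F j) {k | k ∈ A ∧ N.conn k j} := dependsOn_coordAvg_of_insert hdep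
    have hFexp : ∀ j, prodExp p (F j) = prodExp p (f j) := fun j => prodExp_coordAvg i _
    have hle1 : ∀ s, (∀ i, p i (s i) ≠ 0) →
        coordAvg p i (fun s => ∏ j, f j s ^ x j) s ≤ ∏ j, F j s ^ x j :=
      fun s _ => coordAvg_prod_rpow_le hx (hx1 i) hf hupd s
    have hle2 : prodExp p (fun s => ∏ j, F j s ^ x j) ≤ ∏ j, prodExp p (F j) ^ x j :=
      prodExp_prod_rpow_le_of_dependsOn (N := N) hx hx1 A F hF1 hFdep
    have hFeq : prodExp p (fun s => ∏ j, F j s ^ x j) = ∏ j, prodExp p (F j) ^ x j := by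
      refine le_antisymm hle2 ?_
      simp_rw [hFexp]
      rw [← h, ← prodExp_coordAvg i]
      exact prodExp_mono hle1
    have hPne : ∏ j, prodExp p (f j) ^ x j ≠ 0 := Finset.prod_ne_zero_iff.2 fun j _ => by
      rw [Ne, ENNReal.rpow_eq_zero_iff_of_pos (hx j)]; exact h0 j
    have heq : ∀ s, (∀ i, p i (s i) ≠ 0) →
        coordAvg p i (fun s => ∏ j, f j s ^ x j) s = ∏ j, F j s ^ x j := by
      refine eq_of_prodExp_eq hle1 ?_ ?_
      · rw [prodExp_coordAvg, h]
        refine ENNReal.prod_ne_top fun j _ => ENNReal.rpow_ne_top_of_nonneg (hx j).le ?_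
        exact ne_top_of_le_ne_top ENNReal.one_ne_top (prodExp_le_one (hf j))
      · rw [prodExp_coordAvg, h, hFeq]
        simp_rw [hFexp]
    obtain ⟨g, hg⟩ := ih F hF1 hFdep (fun j => by rw [hFexp]; exact h0 j) hFeq
    obtain ⟨s₀, hs₀, hs₀F⟩ := exists_ne_zero_of_prodExp_ne_zero (p := p)
      (f := fun s => ∏ j, F j s ^ x j) (by rw [hFeq]; simpa only [hFexp] using hPne)
    replace hs₀F : ∀ j, F j s₀ ≠ 0 := fun j hj => Finset.prod_ne_zero_iff.1 hs₀F j
      (Finset.mem_univ j) (by rw [hj, ENNReal.zero_rpow_of_pos (hx j)])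
    have hne : ∀ s, (∀ i, p i (s i) ≠ 0) → ∀ j, F j s ≠ 0 →
        ∀ k ∈ A, N.conn k j → g k (s k) ≠ 0 := by
      intro s hs j hj k hk hkj hgk
      apply hj
      rw [hg j s hs, Finset.prod_eq_zero (Finset.mem_filter.2 ⟨hk, hkj⟩) hgk, mul_zero]
    have hFne : ∀ s, (∀ i, p i (s i) ≠ 0) → (∀ k ∈ A, g k (s k) ≠ 0) → ∀ j, F j s ≠ 0 := by
      intro s hs hgs j
      rw [hg j s hs]
      refine mul_ne_zero (by rw [hFexp]; exact h0 j) (Finset.prod_ne_zero_iff.2 fun k hk => ?_)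
      exact hgs k (Finset.mem_filter.1 hk).1
    have hparty : ∀ k, ∃ j, N.conn k j := fun k => by
      obtain ⟨j, -, -, hj, -⟩ := hN k
      exact ⟨j, hj⟩
    have hs₀g : ∀ k ∈ A, g k (s₀ k) ≠ 0 := fun k hk => by
      obtain ⟨j, hj⟩ := hparty k
      exact hne s₀ hs₀ j (hs₀F j) k hk hj
    obtain ⟨j₁, j₂, -, hj₁, hj₂, hj₁₂⟩ := hN i
    have hlocf : ∀ j s s' t, (∀ k, k ≠ i → N.conn k j → s k = s' k) →
        f j (update s i t) = f j (update s' i t) := by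
      intro j s s' t hss
      refine hdep j fun k hk => ?_
      by_cases hki : k = i
      · subst hki; simp
      · rw [update_of_ne hki, update_of_ne hki, hss k hki hk.2]
    have hlocF : ∀ j s s', (∀ k, k ≠ i → N.conn k j → s k = s' k) → F j s = F j s' := by
      intro j s s' hss
      exact hFdep j fun k hk => hss k (fun h => hi (h ▸ hk.1)) hk.2
    set g' : S i → ENNReal := fun t => f j₁ (update s₀ i t) / F j₁ s₀ with hg'
    have key : ∀ s, (∀ k, p k (s k) ≠ 0) → (∀ k ∈ A, g k (s k) ≠ 0) → ∀ t, p i t ≠ 0 →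
        ∀ j, N.conn i j → f j (update s i t) / F j s = g' t := by
      intro s hs hsg t ht j hj
      set s' : ∀ k, S k := fun k => if N.conn k j₁ then s k else s₀ k with hs'
      have hs'p : ∀ k, p k (s' k) ≠ 0 := fun k => by
        simp only [hs']; split_ifs; exacts [hs k, hs₀ k]
      have hs'g : ∀ k ∈ A, g k (s' k) ≠ 0 := fun k hk => by
        simp only [hs']; split_ifs; exacts [hsg k hk, hs₀g k hk]
      have h1 : ∀ k, k ≠ i → N.conn k j₁ → s k = s' k := fun k _ hk => by simp [hs', hk]
      have h2 : ∀ k, k ≠ i → N.conn k j₂ → s' k = s₀ k := fun k hki hk => by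
        have : ¬ N.conn k j₁ := fun hk1 => hki (hj₁₂ k hk1 hk)
        simp [hs', this]
      calc f j (update s i t) / F j s
          = f j₁ (update s i t) / F j₁ s :=
            div_coordAvg_eq hx (hx1 i) hf hupd (hFne s hs hsg) (heq s hs) ht hj hj₁
        _ = f j₁ (update s' i t) / F j₁ s' := by rw [hlocf j₁ s s' t h1, hlocF j₁ s s' h1]
        _ = f j₂ (update s' i t) / F j₂ s' :=
            div_coordAvg_eq hx (hx1 i) hf hupd (hFne s' hs'p hs'g) (heq s' hs'p) ht hj₁ hj₂
        _ = f j₂ (update s₀ i t) / F j₂ s₀ := by rw [hlocf j₂ s' s₀ t h2, hlocF j₂ s' s₀ h2]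
        _ = g' t :=
            div_coordAvg_eq hx (hx1 i) hf hupd hs₀F (heq s₀ hs₀) ht hj₂ hj₁
    have hfF : ∀ j, N.conn i j → ∀ s, (∀ k, p k (s k) ≠ 0) → f j s = F j s * g' (s i) := by
      intro j hj s hs
      by_cases hFs : F j s = 0
      · rw [hFs, zero_mul]
        have := ENNReal.tsum_eq_zero.1 hFs (s i)
        rw [update_eq_self] at this
        exact (mul_eq_zero.1 this).resolve_left (hs i)
      · set s' : ∀ k, S k := fun k => if N.conn k j then s k else s₀ k with hs'
        have hs'p : ∀ k, p k (s' k) ≠ 0 := fun k => by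
          simp only [hs']; split_ifs; exacts [hs k, hs₀ k]
        have hs'g : ∀ k ∈ A, g k (s' k) ≠ 0 := fun k hk => by
          simp only [hs']; split_ifs with hkj
          exacts [hne s hs j hFs k hk hkj, hs₀g k hk]
        have h1 : ∀ k, k ≠ i → N.conn k j → s k = s' k := fun k _ hk => by simp [hs', hk]
        rw [← key s' hs'p hs'g (s i) (hs i) j hj, ← hlocf j s s' _ h1, ← hlocF j s s' h1,
          update_eq_self, ENNReal.mul_div_cancel hFs
            (ne_top_of_le_ne_top ENNReal.one_ne_top (hF1 j s))]
    refine ⟨update g i g', fun j s hs => ?_⟩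
    have hA : ∏ k ∈ A with N.conn k j, update g i g' k (s k) =
        ∏ k ∈ A with N.conn k j, g k (s k) :=
      Finset.prod_congr rfl fun k hk => by
        rw [update_of_ne (fun h : k = i => hi (h ▸ (Finset.mem_filter.1 hk).1))]
    rw [Finset.filter_insert]
    split_ifs with hj
    · rw [Finset.prod_insert (by simp [hi]), hA, update_self, hfF j hj s hs, hg j s hs, hFexp]
      ring
    · have : f j = F j := (coordAvg_of_dependsOn (hdep j) (fun h => hj h.2)).symm
      rw [hA, ← hFexp, ← hg j s hs, this]

open Classical in
/-- If the functions `f j` with values in `[0, 1]` of the sources of the parties `j` attain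
equality in `E ∏ f j ≤ ∏ (E f j) ^ x j`, they are the indicator functions of products of sets. -/
theorem exists_eq_indicator_of_prodExp_prod_eq (hN : N.IsECS) (hx : ∀ j, 0 < x j)
    (hx_lt : ∀ j, x j < 1) (hx1 : ∀ i, ∑ j with N.conn i j, x j = 1)
    (hf : ∀ j s, f j s ≤ 1) (hdep : ∀ j, DependsOn (f j) {i | N.conn i j})
    (h0 : ∀ j, prodExp p (f j) ≠ 0)
    (h : prodExp p (fun s => ∏ j, f j s) = ∏ j, prodExp p (f j) ^ x j) :
    ∃ T : ∀ i, Set (S i), (∀ i, ∃ t ∈ T i, p i t ≠ 0) ∧ ∀ j s, (∀ i, p i (s i) ≠ 0) →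
      f j s = if ∀ i, N.conn i j → s i ∈ T i then 1 else 0 := by
  have hle1 : ∀ s, (∀ i, p i (s i) ≠ 0) → ∏ j, f j s ≤ ∏ j, f j s ^ x j := fun s _ =>
    Finset.prod_le_prod' fun j _ => by
      conv_lhs => rw [← ENNReal.rpow_one (f j s)]
      exact ENNReal.rpow_le_rpow_of_exponent_ge (hf j s) (hx_lt j).le
  have hdep' : ∀ j, DependsOn (f j) {i | i ∈ Finset.univ ∧ N.conn i j} := by simpa using hdep
  have hle2 := prodExp_prod_rpow_le_of_dependsOn (p := p) hx hx1 Finset.univ f hf hdep'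
  have hle3 : prodExp p (fun s => ∏ j, f j s) ≤ prodExp p (fun s => ∏ j, f j s ^ x j) :=
    prodExp_mono hle1
  have heq : prodExp p (fun s => ∏ j, f j s ^ x j) = ∏ j, prodExp p (f j) ^ x j :=
    le_antisymm hle2 (h ▸ hle3)
  have hpt : ∀ s, (∀ i, p i (s i) ≠ 0) → ∏ j, f j s = ∏ j, f j s ^ x j := by
    refine eq_of_prodExp_eq hle1 ?_ (h.trans heq.symm)
    exact ne_top_of_le_ne_top ENNReal.one_ne_top
      (prodExp_le_one fun s => Finset.prod_le_one' fun j _ => hf j s)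
  obtain ⟨g, hg⟩ := exists_eq_prod_of_prodExp_prod_rpow_eq hN hx hx1 Finset.univ f hf hdep' h0 heq
  have hone : ∀ s, (∀ i, p i (s i) ≠ 0) → (∀ j, f j s ≠ 0) → ∀ j, f j s = 1 := by
    intro s hs hne j
    by_contra hj
    have hprod := hpt s hs
    rw [← Finset.mul_prod_erase _ _ (Finset.mem_univ j),
      ← Finset.mul_prod_erase _ (fun j => f j s ^ x j) (Finset.mem_univ j)] at hprod
    have hr0 : ∏ k ∈ Finset.univ.erase j, f k s ≠ 0 := Finset.prod_ne_zero_iff.2 fun k _ => hne k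
    have hrT : ∏ k ∈ Finset.univ.erase j, f k s ≠ ⊤ := ENNReal.prod_ne_top fun k _ =>
      ne_top_of_le_ne_top ENNReal.one_ne_top (hf k s)
    have hrle : ∏ k ∈ Finset.univ.erase j, f k s ≤ ∏ k ∈ Finset.univ.erase j, f k s ^ x k :=
      Finset.prod_le_prod' fun k _ => by
        conv_lhs => rw [← ENNReal.rpow_one (f k s)]
        exact ENNReal.rpow_le_rpow_of_exponent_ge (hf k s) (hx_lt k).le
    have hlt : f j s < f j s ^ x j := by
      conv_lhs => rw [← ENNReal.rpow_one (f j s)]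
      exact ENNReal.rpow_lt_rpow_of_exponent_gt (pos_iff_ne_zero.2 (hne j))
        ((hf j s).lt_of_ne hj) (hx_lt j)
    refine ((ENNReal.mul_lt_mul_iff_left hr0 hrT).2 hlt).not_ge ?_
    rw [hprod]
    gcongr
  obtain ⟨s₀, hs₀, hs₀f⟩ := exists_ne_zero_of_prodExp_ne_zero (p := p)
      (f := fun s => ∏ j, f j s) (by
        rw [h]
        refine Finset.prod_ne_zero_iff.2 fun j _ => ?_
        rw [Ne, ENNReal.rpow_eq_zero_iff_of_pos (hx j)]; exact h0 j)
  replace hs₀f : ∀ j, f j s₀ ≠ 0 := fun j => Finset.prod_ne_zero_iff.1 hs₀f j (Finset.mem_univ j)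
  have hs₀g : ∀ i, g i (s₀ i) ≠ 0 := fun i hi => by
    obtain ⟨j, -, -, hj, -⟩ := hN i
    apply hs₀f j
    rw [hg j s₀ hs₀, Finset.prod_eq_zero (Finset.mem_filter.2 ⟨Finset.mem_univ i, hj⟩) hi, mul_zero]
  refine ⟨fun i => {t | g i t ≠ 0}, fun i => ⟨s₀ i, hs₀g i, hs₀ i⟩, fun j s hs => ?_⟩
  split_ifs with hT
  · set s' : ∀ k, S k := fun k => if N.conn k j then s k else s₀ k with hs'
    have hs'p : ∀ k, p k (s' k) ≠ 0 := fun k => by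
      simp only [hs']; split_ifs; exacts [hs k, hs₀ k]
    have hs'g : ∀ k, g k (s' k) ≠ 0 := fun k => by
      simp only [hs']; split_ifs with hkj
      exacts [hT k hkj, hs₀g k]
    rw [hdep j (y := s') fun k hk => by simp [hs', show N.conn k j from hk]]
    refine hone s' hs'p (fun j => ?_) j
    rw [hg j s' hs'p]
    exact mul_ne_zero (h0 j) (Finset.prod_ne_zero_iff.2 fun k _ => hs'g k)
  · push Not at hT
    obtain ⟨i, hi, hiT⟩ := hT
    rw [hg j s hs, Finset.prod_eq_zero (Finset.mem_filter.2 ⟨Finset.mem_univ i, hi⟩)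
      (by simpa using hiT), mul_zero]

end Finner

section Marginals

variable {I J : Type*} {N : Network I J} {Out : J → Type*} {κ : I → J → Type*}

theorem ClassicalStrategy.dependsOn_resp (σ : ClassicalStrategy N Out) (j : J) (a : Out j) :
    DependsOn (fun s : (∀ i, σ.S i) => σ.resp j (fun i => s i) a) {i | N.conn i j} := by
  intro s s' h
  have : (fun i : N.SourceOf j => s i) = fun i : N.SourceOf j => s' i := funext fun i => h i i.2
  simp only [this]

theorem QuantumStrategy.view_injective :
    Function.Injective (QuantumStrategy.view : QuantumStrategy.GlobalIndex N κ →
      ∀ j, ∀ i : N.SourceOf j, κ i j) := by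
  intro w w' h
  ext i j
  exact congrFun (congrFun h j.1) ⟨i, j.2⟩

variable [Fintype I] [Fintype J]

namespace ClassicalStrategy

open Classical in
theorem sum_prob_piFinset (σ : ClassicalStrategy N Out) (t : ∀ j, Finset (Out j)) :
    ∑ a ∈ Fintype.piFinset t, σ.prob a =
      prodExp σ.src (fun s => ∏ j, ∑ b ∈ t j, σ.resp j (fun i => s i) b) := by
  simp_rw [prob, prodExp]
  rw [← Summable.tsum_finsetSum fun _ _ => ENNReal.summable]
  refine tsum_congr fun s => ?_
  rw [← Finset.mul_sum, Finset.prod_univ_sum]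

variable [∀ j, Fintype (Out j)]

open Classical in
theorem sum_prob_cylinder (σ : ClassicalStrategy N Out) (K : Finset J) (a : ∀ j, Out j) :
    ∑ a' ∈ Fintype.piFinset (fun j => if j ∈ K then {a j} else Finset.univ), σ.prob a' =
      prodExp σ.src (fun s => ∏ j ∈ K, σ.resp j (fun i => s i) (a j)) := by
  rw [sum_prob_piFinset]
  refine prodExp_congr fun s _ => ?_
  rw [← Finset.prod_subset (Finset.subset_univ K)]
  · exact Finset.prod_congr rfl fun j hj => by simp [hj]
  · intro j _ hj
    simp only [hj, if_false]
    rw [← tsum_fintype (L := .unconditional _), PMF.tsum_coe]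

end ClassicalStrategy

namespace QuantumStrategy

variable [∀ j, Fintype (Out j)] [∀ i j, Fintype (κ i j)]
  {Q : QuantumStrategy N Out κ} {C : ℕ}

open Classical in
theorem sum_prob_piFinset (Q : QuantumStrategy N Out κ) (t : ∀ j, Finset (Out j))
    (P : ∀ j, (∀ i : N.SourceOf j, κ i j) → Prop)
    (ht : ∀ j, ∑ b ∈ t j, Q.meas j b = Matrix.diagonal fun v => if P j v then 1 else 0) :
    ∑ a ∈ Fintype.piFinset t, Q.prob a =
      ∑ w : GlobalIndex N κ, if ∀ j, P j (view w j) then ‖Q.globalState w‖ ^ 2 else 0 := by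
  have hM : ∀ w w' : GlobalIndex N κ, ∑ a ∈ Fintype.piFinset t, Q.globalMeas a w w' =
      if w = w' ∧ ∀ j, P j (view w j) then 1 else 0 := by
    intro w w'
    simp only [globalMeas, Matrix.of_apply]
    rw [← Finset.prod_univ_sum t (fun j b => Q.meas j b (view w j) (view w' j))]
    have : ∀ j, ∑ b ∈ t j, Q.meas j b (view w j) (view w' j) =
        if view w j = view w' j ∧ P j (view w j) then 1 else 0 := by
      intro j
      have h := congrFun (congrFun (ht j) (view w j)) (view w' j)
      rw [Matrix.sum_apply] at h
      rw [h, Matrix.diagonal_apply, ite_and]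
    simp_rw [this]
    rw [Finset.prod_ite_zero]
    simp only [Finset.mem_univ, true_imp_iff, forall_and, Finset.prod_const_one]
    congr 1
    exact propext (and_congr_left fun _ =>
      ⟨fun h => view_injective (funext h), fun h _ => h ▸ rfl⟩)
  calc ∑ a ∈ Fintype.piFinset t, Q.prob a
      = (∑ w : GlobalIndex N κ, ∑ w' : GlobalIndex N κ, Q.globalState w * star (Q.globalState w') *
          ∑ a ∈ Fintype.piFinset t, Q.globalMeas a w' w).re := by
        simp only [prob, Matrix.trace, Matrix.diag, Matrix.mul_apply, Matrix.vecMulVec_apply,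
          Pi.star_apply]
        rw [← Complex.re_sum, Finset.sum_comm]
        simp_rw [Finset.mul_sum]
        congr 1
        refine Finset.sum_congr rfl fun w _ => ?_
        rw [Finset.sum_comm]
    _ = _ := by
        rw [Complex.re_sum]
        refine Finset.sum_congr rfl fun w _ => ?_
        simp_rw [hM]
        rw [Finset.sum_eq_single w (fun w' _ hw' => by simp [hw']) (by simp)]
        simp only [true_and]
        split_ifs
        · rw [mul_one, Complex.star_def, Complex.mul_conj, Complex.ofReal_re,
            Complex.normSq_eq_norm_sq]
        · simp

namespace ColorMatching

open Classical in
/-- The probability that the source `i` distributes to each of its parties `j ∈ K` a basis vector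
of the color `c j i`. -/
noncomputable def sourceWeight (M : Q.ColorMatching C) (K : Finset J)
    (c : ∀ j, N.SourceOf j → Fin C) (i : I) : ℝ :=
  ∑ w with (∀ j : N.PartyOf i, j.1 ∈ K → M.color i j (w j) = c j ⟨i, j.2⟩), ‖Q.state i w‖ ^ 2

variable (M : Q.ColorMatching C) {K : Finset J} {c : ∀ j, N.SourceOf j → Fin C}

open Classical in
theorem sum_prob_cylinder {a : ∀ j, Out j} (ha : ∀ j ∈ K, M.IsOutcome j (c j) (a j)) :
    ∑ a' ∈ Fintype.piFinset (fun j => if j ∈ K then {a j} else Finset.univ), Q.prob a' =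
      ∏ i, M.sourceWeight K c i := by
  rw [sum_prob_piFinset Q _
    (fun j v => j ∈ K → ∀ i : N.SourceOf j, M.color i j (v i) = c j i) fun j => ?_]
  · simp_rw [sourceWeight, Finset.sum_filter]
    rw [Finset.prod_univ_sum, Fintype.piFinset_univ]
    refine Finset.sum_congr rfl fun w _ => ?_
    rw [Finset.prod_ite_zero, globalState, norm_prod, Finset.prod_pow]
    congr 1
    refine propext ⟨fun h i _ j hj => h j hj ⟨i, j.2⟩, fun h j hj i =>
      h i (Finset.mem_univ _) ⟨j, i.2⟩ hj⟩
  · by_cases hj : j ∈ K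
    · simp only [hj, if_true, Finset.sum_singleton, true_imp_iff]
      rw [ha j hj, colorProj]
    · simp only [hj, if_false, Q.meas_sum, false_imp_iff, if_true, Matrix.diagonal_one]

theorem sourceWeight_eq_one {i : I} (h : ∀ j ∈ K, ¬ N.conn i j) : M.sourceWeight K c i = 1 := by
  classical
  rw [sourceWeight, Finset.filter_true_of_mem (by intro w _ j hj; exact absurd j.2 (h j hj))]
  convert Q.state_norm i

theorem sourceWeight_eq_pcolor {i : I} {γ : Fin C}
    (hc : ∀ j ∈ K, ∀ hj : N.conn i j, c j ⟨i, hj⟩ = γ) (h : ∃ j ∈ K, N.conn i j) :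
    M.sourceWeight K c i = M.pcolor γ := by
  classical
  obtain ⟨j₀, hj₀, hij₀⟩ := h
  rw [← M.color_weight i γ, sourceWeight, Finset.sum_filter, Finset.sum_filter]
  refine Finset.sum_congr rfl fun w _ => ?_
  by_cases hw : Q.state i w = 0
  · simp [hw]
  · obtain ⟨γ', hγ'⟩ := M.same_color i w hw
    congr 1
    refine propext ⟨fun h j => ?_, fun h j hj => ?_⟩
    · rw [hγ', ← hγ' ⟨j₀, hij₀⟩, h ⟨j₀, hij₀⟩ hj₀, hc j₀ hj₀ hij₀]
    · rw [h, hc j hj j.2]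

theorem sourceWeight_eq_zero {i : I} {j j' : J} (hj : j ∈ K) (hj' : j' ∈ K) (hij : N.conn i j)
    (hij' : N.conn i j') (h : c j ⟨i, hij⟩ ≠ c j' ⟨i, hij'⟩) : M.sourceWeight K c i = 0 := by
  classical
  refine Finset.sum_eq_zero fun w hw => ?_
  have hw := (Finset.mem_filter.1 hw).2
  by_contra hne
  obtain ⟨γ, hγ⟩ := M.same_color i w (by rintro h0; simp [h0] at hne)
  exact h (by rw [← hw ⟨j, hij⟩ hj, ← hw ⟨j', hij'⟩ hj', hγ, hγ])

theorem _root_.QuantumStrategy.SimulatedBy.prob_nonneg {σ : ClassicalStrategy N Out}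
    (hσ : Q.SimulatedBy σ) (M : Q.ColorMatching C) (a : ∀ j, Out j) : 0 ≤ Q.prob a := by
  classical
  have hc : 0 < C := by
    rcases Nat.eq_zero_or_pos C with rfl | h
    · simpa using M.pcolor_sum
    · exact h
  have hQ : ∑ a, Q.prob a = 1 := by
    have h := M.sum_prob_cylinder (K := ∅) (c := fun _ _ => ⟨0, hc⟩) (a := a) (by simp)
    simp only [Finset.notMem_empty, if_false, Fintype.piFinset_univ] at h
    rw [h]
    exact Finset.prod_eq_one fun i _ => M.sourceWeight_eq_one (by simp)
  have hσ1 : ∑ a, σ.prob a = 1 := by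
    have h := σ.sum_prob_cylinder ∅ a
    simp only [Finset.notMem_empty, if_false, Fintype.piFinset_univ, Finset.prod_empty,
      prodExp_const] at h
    exact h
  have hmax : ∑ a, max (Q.prob a) 0 = 1 := by
    have h := congrArg ENNReal.toReal hσ1
    rw [Finset.sum_congr rfl fun a _ => hσ a,
      ENNReal.toReal_sum fun a _ => ENNReal.ofReal_ne_top] at h
    simpa [ENNReal.toReal_ofReal'] using h
  have := (Finset.sum_eq_sum_iff_of_le (s := Finset.univ)
    (fun a _ => le_max_left (Q.prob a) 0)).1 (hQ.trans hmax.symm) a (Finset.mem_univ a)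
  rw [this]
  exact le_max_right _ _

/-- The probability that, in a classical strategy with the same output distribution, all parties
`j ∈ K` output `a j`, if this is the outcome of the basis vector of the colors `c j`. -/
theorem prodExp_prod_resp {σ : ClassicalStrategy N Out} (hσ : Q.SimulatedBy σ)
    {a : ∀ j, Out j} (ha : ∀ j ∈ K, M.IsOutcome j (c j) (a j)) :
    prodExp σ.src (fun s => ∏ j ∈ K, σ.resp j (fun i => s i) (a j)) =
      ENNReal.ofReal (∏ i, M.sourceWeight K c i) := by
  classical
  rw [← σ.sum_prob_cylinder, ← M.sum_prob_cylinder ha,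
    ENNReal.ofReal_sum_of_nonneg fun a _ => hσ.prob_nonneg M a]
  exact Finset.sum_congr rfl fun a _ => hσ a

end ColorMatching

end QuantumStrategy

end Marginals

section Gibbs

variable {G I : Type*} [Fintype G] [Fintype I]

theorem Real.sub_sub_mul_log_div_nonneg {p q : ℝ} (hp : 0 < p) (hq : 0 < q) :
    0 ≤ q - p - p * Real.log (q / p) := by
  have h := mul_le_mul_of_nonneg_left (Real.log_le_sub_one_of_pos (div_pos hq hp)) hp.le
  rw [mul_sub, mul_div_cancel₀ _ hp.ne'] at h
  linarith

theorem Real.eq_of_sub_sub_mul_log_div_eq_zero {p q : ℝ} (hp : 0 < p) (hq : 0 < q)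
    (h : q - p - p * Real.log (q / p) = 0) : q = p := by
  by_contra hne
  have hne' : q / p ≠ 1 := by rwa [Ne, div_eq_one_iff_eq hp.ne']
  have h' := mul_lt_mul_of_pos_left (Real.log_lt_sub_one_of_pos (div_pos hq hp) hne') hp
  rw [mul_sub, mul_div_cancel₀ _ hp.ne'] at h'
  linarith

/-- A form of Gibbs' inequality: subprobability vectors `q · i` whose products over `i` are those
of a probability vector `p` are all equal to `p`. -/
theorem eq_of_prod_eq_of_sum_le_one {p : G → ℝ} {q : G → I → ℝ} (hp : ∀ g, 0 < p g)
    (hp1 : ∑ g, p g = 1) (hq : ∀ g i, 0 < q g i) (hq1 : ∀ i, ∑ g, q g i ≤ 1)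
    (h : ∀ g, ∏ i, q g i = ∏ _i : I, p g) (g : G) (i : I) : q g i = p g := by
  have hlog : ∀ g, ∑ i, Real.log (q g i / p g) = 0 := fun g => by
    rw [← Real.log_prod fun i _ => (div_pos (hq g i) (hp g)).ne', Finset.prod_div_distrib, h g,
      div_self (Finset.prod_pos fun _ _ => hp g).ne', Real.log_one]
  have hsum : ∑ g, ∑ i, (q g i - p g - p g * Real.log (q g i / p g)) ≤ 0 := by
    simp_rw [Finset.sum_sub_distrib, ← Finset.mul_sum, hlog]
    simp only [mul_zero, Finset.sum_const_zero, sub_zero]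
    rw [Finset.sum_comm, Finset.sum_comm (f := fun g _ => p g), hp1, ← Finset.sum_sub_distrib]
    exact Finset.sum_nonpos fun i _ => by linarith [hq1 i]
  have hnn : ∀ g i, 0 ≤ q g i - p g - p g * Real.log (q g i / p g) := fun g i =>
    Real.sub_sub_mul_log_div_nonneg (hp g) (hq g i)
  refine Real.eq_of_sub_sub_mul_log_div_eq_zero (hp g) (hq g i) ?_
  have h1 := (Finset.sum_eq_zero_iff_of_nonneg
    (fun g _ => Finset.sum_nonneg fun i _ => hnn g i)).1
    (hsum.antisymm (Finset.sum_nonneg fun g _ => Finset.sum_nonneg fun i _ => hnn g i))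
    g (Finset.mem_univ g)
  exact (Finset.sum_eq_zero_iff_of_nonneg fun i _ => hnn g i).1 h1 i (Finset.mem_univ i)

end Gibbs

section Indicator

theorem ENNReal.prod_rpow_const {J : Type*} {b : ENNReal} (hb : b ≠ 0) (hb' : b ≠ ⊤) (s : Finset J)
    (x : J → ℝ) : ∏ j ∈ s, b ^ x j = b ^ ∑ j ∈ s, x j := by
  classical
  induction s using Finset.induction_on with
  | empty => simp
  | insert j s hj ih => rw [Finset.prod_insert hj, Finset.sum_insert hj, ENNReal.rpow_add _ _ hb hb', ih]

variable {I : Type*} [Fintype I] {S : I → Type*} {p : ∀ i, PMF (S i)}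

open Classical in
theorem prodExp_indicator (P : I → Prop) (T : ∀ i, Set (S i)) :
    prodExp p (fun s => if ∀ i, P i → s i ∈ T i then 1 else 0) =
      ∏ i with P i, ∑' t, p i t * if t ∈ T i then 1 else 0 := by
  have : (fun s : ∀ i, S i => if ∀ i, P i → s i ∈ T i then (1 : ENNReal) else 0) =
      fun s => ∏ i, if P i → s i ∈ T i then 1 else 0 := by
    ext s
    rw [Finset.prod_ite_zero]
    simp
  rw [this, prodExp_prod (fun i t => if P i → t ∈ T i then 1 else 0), Finset.prod_filter]
  refine Finset.prod_congr rfl fun i _ => ?_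
  by_cases hi : P i
  · simp [hi]
  · simp [hi, PMF.tsum_coe]

end Indicator

section Rigidity

variable {I J : Type*} {N : Network I J} {Out : J → Type*}

theorem ClassicalStrategy.outputsIff_of_forall (σ : ClassicalStrategy N Out) {j : J} {a : Out j}
    {E : (∀ i : N.SourceOf j, σ.S i) → Prop}
    (h : ∀ s : (∀ i, σ.S i), (∀ i, σ.src i (s i) ≠ 0) →
      (E (fun i => s i) → σ.resp j (fun i => s i) a = 1) ∧
      (¬ E (fun i => s i) → σ.resp j (fun i => s i) a = 0)) : σ.OutputsIff j a E := by
  classical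
  intro s hs
  obtain ⟨s₀, hs₀⟩ := exists_mem_support σ.src
  let s' : ∀ i, σ.S i := fun i => if hi : N.conn i j then s ⟨i, hi⟩ else s₀ i
  have hs' : (fun i : N.SourceOf j => s' i) = s := funext fun i => by
    simp only [s', i.2, dif_pos]
  rw [← hs']
  refine h s' fun i => ?_
  by_cases hi : N.conn i j
  · simp only [s', hi, dif_pos]
    exact hs ⟨i, hi⟩
  · simp only [s', hi, dif_neg, not_false_iff]
    exact hs₀ i

theorem Network.exists_restrict_eq (N : Network I J) {X : Type*} [Nonempty X] {j : J}
    (c : N.SourceOf j → X) : ∃ c' : I → X, N.restrict c' j = c := by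
  classical
  refine ⟨fun i => if hi : N.conn i j then c ⟨i, hi⟩ else Classical.arbitrary X, funext fun i => ?_⟩
  simp only [Network.restrict, i.2, dif_pos]

open Classical in
theorem ClassicalStrategy.outputsIff_of_resp_eq_ite [Fintype I] (σ : ClassicalStrategy N Out)
    {X : Type*} {col : ∀ i, σ.S i → X} {j : J} {c : I → X} {a : Out j}
    (h : ∀ s : (∀ i, σ.S i), (∀ i, σ.src i (s i) ≠ 0) →
      σ.resp j (fun i => s i) a = if ∀ i, N.conn i j → col i (s i) = c i then 1 else 0) :
    σ.OutputsIff j a fun s => ∀ i : N.SourceOf j, col i (s i) = N.restrict c j i := by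
  refine σ.outputsIff_of_forall fun s hs => ?_
  rw [h s hs]
  simp only [Subtype.forall, Network.restrict]
  exact ⟨fun h => if_pos h, fun h => if_neg h⟩

variable [Fintype I] [Fintype J] [∀ j, Fintype (Out j)] {κ : I → J → Type*}
  [∀ i j, Fintype (κ i j)] {Q : QuantumStrategy N Out κ} {C : ℕ}

namespace QuantumStrategy.ColorMatching

theorem isOutcome_matchOut (M : Q.ColorMatching C) (j : J) (γ : Fin C) :
    M.IsOutcome j (N.restrict (fun _ => γ) j) (M.matchOut j γ) := M.meas_matchOut j γ

theorem nonempty_colors (M : Q.ColorMatching C) : Nonempty (Fin C) := by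
  by_contra h
  rw [not_nonempty_iff] at h
  simpa using M.pcolor_sum

variable (M : Q.ColorMatching C) {σ : ClassicalStrategy N Out} (hσ : Q.SimulatedBy σ)

include hσ in
open Classical in
theorem prodExp_prod_resp_restrict {K : Finset J} {c : I → Fin C} {a : ∀ j, Out j}
    (ha : ∀ j ∈ K, M.IsOutcome j (N.restrict c j) (a j)) :
    prodExp σ.src (fun s => ∏ j ∈ K, σ.resp j (fun i => s i) (a j)) =
      ∏ i with ∃ j ∈ K, N.conn i j, ENNReal.ofReal (M.pcolor (c i)) := by
  rw [M.prodExp_prod_resp hσ ha, ← ENNReal.ofReal_prod_of_nonneg fun i _ => (M.pcolor_pos _).le,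
    Finset.prod_filter]
  congr 1
  refine Finset.prod_congr rfl fun i _ => ?_
  split_ifs with h
  · exact M.sourceWeight_eq_pcolor (fun j _ hj => rfl) h
  · exact M.sourceWeight_eq_one (by simpa using h)

include hσ in
open Classical in
theorem prodExp_resp_restrict {j : J} {c : I → Fin C} {a : Out j}
    (ha : M.IsOutcome j (N.restrict c j) a) :
    prodExp σ.src (fun s => σ.resp j (fun i => s i) a) =
      ∏ i with N.conn i j, ENNReal.ofReal (M.pcolor (c i)) := by
  obtain ⟨γ⟩ := M.nonempty_colors
  have h := M.prodExp_prod_resp_restrict hσ (K := {j}) (c := c)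
    (a := update (fun k => M.matchOut k γ) j a) (by simpa using ha)
  simpa using h

include hσ in
/-- A party does not output the basis vector of the colors `c` when another one outputs a color
match that contradicts the color of a common source. -/
theorem resp_mul_resp_matchOut_eq_zero {j j' : J} (hjj : j ≠ j') {c : I → Fin C} {a : Out j}
    (ha : M.IsOutcome j (N.restrict c j) a) {γ : Fin C} {i : I} (hj : N.conn i j)
    (hj' : N.conn i j') (hγ : c i ≠ γ) (s : ∀ i, σ.S i) (hs : ∀ i, σ.src i (s i) ≠ 0) :
    σ.resp j (fun i => s i) a * σ.resp j' (fun i => s i) (M.matchOut j' γ) = 0 := by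
  classical
  have hsrc : M.sourceWeight {j, j'} (update (fun _ _ => γ) j (N.restrict c j)) i = 0 :=
    M.sourceWeight_eq_zero (j := j) (j' := j') (by simp) (by simp) hj hj'
      (by rw [update_self, update_of_ne hjj.symm]; exact hγ)
  have h := M.prodExp_prod_resp hσ (K := {j, j'})
    (c := update (fun _ _ => γ) j (N.restrict c j))
    (a := update (fun k => M.matchOut k γ) j a) (by
      intro k hk
      by_cases hkj : k = j
      · subst hkj; simpa using ha
      · rw [update_of_ne hkj, update_of_ne hkj]
        exact M.isOutcome_matchOut k γ)
  rw [Finset.prod_eq_zero (Finset.mem_univ i) hsrc, ENNReal.ofReal_zero] at h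
  have h0 := eq_zero_of_prodExp_eq_zero h s hs
  rwa [Finset.prod_pair hjj, update_self, update_of_ne hjj.symm] at h0

include hσ in
/-- If all parties have an outcome for a global assignment of colors, they output it exactly on a
product of sets of values of the sources. -/
theorem exists_resp_eq_indicator (hECS : N.IsECS) (hPFIS : N.AdmitsPFIS) {c : I → Fin C}
    {a : ∀ j, Out j} (ha : ∀ j, M.IsOutcome j (N.restrict c j) (a j)) :
    ∃ T : ∀ i, Set (σ.S i), (∀ i, ∃ t ∈ T i, σ.src i t ≠ 0) ∧
      ∀ j (s : ∀ i, σ.S i), (∀ i, σ.src i (s i) ≠ 0) →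
        ((∀ i, N.conn i j → s i ∈ T i) → σ.resp j (fun i => s i) (a j) = 1) ∧
        ((¬ ∀ i, N.conn i j → s i ∈ T i) → σ.resp j (fun i => s i) (a j) = 0) := by
  classical
  obtain ⟨x, hx, hx1⟩ := hPFIS
  have hpos : ∀ i, ENNReal.ofReal (M.pcolor (c i)) ≠ 0 := fun i => by
    simpa using M.pcolor_pos (c i)
  have hone := fun j => M.prodExp_resp_restrict hσ (ha j)
  have hall := M.prodExp_prod_resp_restrict hσ (K := Finset.univ) fun j _ => ha j
  obtain ⟨T, hT, hTf⟩ := exists_eq_indicator_of_prodExp_prod_eq (p := σ.src) hECS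
    (fun j => (hx j).1) (fun j => (hx j).2) (by convert hx1)
    (f := fun j s => σ.resp j (fun i => s i) (a j)) (fun j s => PMF.coe_le_one _ _)
    (fun j => σ.dependsOn_resp j (a j))
    (fun j => by rw [hone]; exact Finset.prod_ne_zero_iff.2 fun i _ => hpos i)
    (by
      have hcov : ∀ i, ∃ j, N.conn i j := fun i => by
        obtain ⟨j, -, -, hj, -⟩ := hECS i
        exact ⟨j, hj⟩
      rw [hall]
      simp_rw [hone, Finset.mem_univ, true_and, Finset.prod_filter, if_pos (hcov _)]
      simp_rw [← ENNReal.prod_rpow_of_nonneg (hx _).1.le]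
      rw [Finset.prod_comm]
      refine Finset.prod_congr rfl fun i _ => ?_
      have : ∀ j, (if N.conn i j then ENNReal.ofReal (M.pcolor (c i)) else 1) ^ x j =
          if N.conn i j then ENNReal.ofReal (M.pcolor (c i)) ^ x j else 1 := fun j => by
        split_ifs <;> simp
      simp_rw [this]
      rw [← Finset.prod_filter, ENNReal.prod_rpow_const (hpos i) ENNReal.ofReal_ne_top]
      convert (ENNReal.rpow_one _).symm
      convert hx1 i)
  refine ⟨T, hT, fun j s hs => ⟨fun h => ?_, fun h => ?_⟩⟩
  · rw [hTf j s hs, if_pos h]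
  · rw [hTf j s hs, if_neg h]

include hσ in
theorem exists_isColoring (hECS : N.IsECS) (hPFIS : N.AdmitsPFIS) :
    ∃ col : (∀ i, σ.S i → Fin C), M.IsColoring σ col := by
  classical
  choose T hT hTf using fun γ : Fin C =>
    M.exists_resp_eq_indicator hσ hECS hPFIS fun j => M.isOutcome_matchOut j γ
  choose t₀ ht₀T ht₀ using hT
  have hdisj : ∀ i t, σ.src i t ≠ 0 → ∀ γ γ', t ∈ T γ i → t ∈ T γ' i → γ = γ' := by
    intro i t ht γ γ' hγ hγ'
    by_contra hne
    obtain ⟨j, j', hjj, hj, hj', hu⟩ := hECS i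
    let s : ∀ k, σ.S k := update (fun k => if N.conn k j then t₀ γ k else t₀ γ' k) i t
    have hs : ∀ k, σ.src k (s k) ≠ 0 := fun k => by
      by_cases hk : k = i
      · subst hk; simpa [s] using ht
      · simp only [s, update_of_ne hk]
        split_ifs; exacts [ht₀ γ k, ht₀ γ' k]
    have h := M.resp_mul_resp_matchOut_eq_zero hσ hjj (M.isOutcome_matchOut j γ) hj hj' hne s hs
    rw [((hTf γ j s hs).1 fun k hk => ?_), ((hTf γ' j' s hs).1 fun k hk => ?_)] at h
    · simp at h
    · by_cases hki : k = i
      · subst hki; simpa [s] using hγ'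
      · have : ¬ N.conn k j := fun h => hki (hu k h hk)
        simpa [s, update_of_ne hki, this] using ht₀T γ' k
    · by_cases hki : k = i
      · subst hki; simpa [s] using hγ
      · simpa [s, update_of_ne hki, hk] using ht₀T γ k
  let q : Fin C → I → ENNReal := fun γ i => ∑' t, σ.src i t * if t ∈ T γ i then 1 else 0
  have hqprod : ∀ γ, ∏ i, q γ i = ∏ _i : I, ENNReal.ofReal (M.pcolor γ) := by
    intro γ
    have hcov : ∀ i, ∃ j, N.conn i j := fun i => by
      obtain ⟨j, -, -, hj, -⟩ := hECS i
      exact ⟨j, hj⟩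
    have h1 := prodExp_indicator (p := σ.src) (fun _ => True) (T γ)
    have h2 := M.prodExp_prod_resp_restrict hσ (K := Finset.univ)
      fun j _ => M.isOutcome_matchOut j γ
    simp only [Finset.filter_true, true_imp_iff] at h1
    simp only [Finset.mem_univ, true_and, hcov, Finset.filter_true] at h2
    rw [← h1, ← h2]
    refine prodExp_congr fun s hs => ?_
    split_ifs with h
    · exact (Finset.prod_eq_one fun j _ => (hTf γ j s hs).1 fun i _ => h i).symm
    · push Not at h
      obtain ⟨i, hi⟩ := h
      obtain ⟨j, hj⟩ := hcov i
      exact (Finset.prod_eq_zero (Finset.mem_univ j)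
        ((hTf γ j s hs).2 fun h => hi (h i hj))).symm
  have hind : ∀ i t, σ.src i t ≠ 0 → ∑ γ, (if t ∈ T γ i then (1 : ENNReal) else 0) ≤ 1 := by
    intro i t ht
    rw [Finset.sum_boole]
    exact_mod_cast Finset.card_le_one.2 fun γ hγ γ' hγ' =>
      hdisj i t ht γ γ' (Finset.mem_filter.1 hγ).2 (Finset.mem_filter.1 hγ').2
  have hqsum : ∀ i, ∑ γ, q γ i = ∑' t, σ.src i t * ∑ γ, if t ∈ T γ i then 1 else 0 := by
    intro i
    simp_rw [Finset.mul_sum]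
    rw [Summable.tsum_finsetSum fun _ _ => ENNReal.summable]
  have hq1 : ∀ i, ∑ γ, q γ i ≤ 1 := by
    intro i
    have h : ∑' t, σ.src i t * ∑ γ, (if t ∈ T γ i then (1 : ENNReal) else 0) ≤
        ∑' t, σ.src i t * 1 := by
      refine ENNReal.tsum_le_tsum fun t => ?_
      by_cases ht : σ.src i t = 0
      · simp [ht]
      · gcongr
        exact hind i t ht
    rw [hqsum]
    simpa only [mul_one, PMF.tsum_coe] using h
  have hqtop : ∀ γ i, q γ i ≠ ⊤ := fun γ i => ne_top_of_le_ne_top ENNReal.one_ne_top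
    ((Finset.single_le_sum (fun _ _ => zero_le) (Finset.mem_univ γ)).trans (hq1 i))
  have hq0 : ∀ γ i, q γ i ≠ 0 := by
    intro γ i h
    have := hqprod γ
    rw [Finset.prod_eq_zero (Finset.mem_univ i) h] at this
    refine Finset.prod_ne_zero_iff.2 (fun i _ => ?_) this.symm
    simpa using M.pcolor_pos γ
  have hqp : ∀ γ i, q γ i = ENNReal.ofReal (M.pcolor γ) := by
    intro γ i
    have := eq_of_prod_eq_of_sum_le_one (q := fun γ i => (q γ i).toReal) M.pcolor_pos M.pcolor_sum
      (fun γ i => ENNReal.toReal_pos (hq0 γ i) (hqtop γ i))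
      (fun i => by
        rw [← ENNReal.toReal_sum fun γ _ => hqtop γ i]
        exact ENNReal.toReal_le_of_le_ofReal zero_le_one (by simpa using hq1 i))
      (fun γ => by
        have h := congrArg ENNReal.toReal (hqprod γ)
        rw [ENNReal.toReal_prod, ENNReal.toReal_prod, ENNReal.toReal_ofReal (M.pcolor_pos γ).le] at h
        exact h) γ i
    rw [← this, ENNReal.ofReal_toReal (hqtop γ i)]
  have hcover : ∀ i t, σ.src i t ≠ 0 → ∃ γ, t ∈ T γ i := by
    intro i t ht
    have h1 : ∑' t, σ.src i t * ∑ γ, (if t ∈ T γ i then (1 : ENNReal) else 0) = 1 := by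
      rw [← hqsum]
      simp_rw [hqp]
      rw [← ENNReal.ofReal_sum_of_nonneg fun γ _ => (M.pcolor_pos γ).le, M.pcolor_sum,
        ENNReal.ofReal_one]
    have h2 := ENNReal.eq_of_tsum_mul_eq (w := σ.src i) (g := fun _ => 1) (hind i)
      (fun t => (σ.src i).apply_ne_top t) (by rw [h1]; exact ENNReal.one_ne_top)
      (by rw [h1]; simp [PMF.tsum_coe]) t ht
    by_contra hno
    push Not at hno
    simp [hno] at h2
  obtain ⟨γ₀⟩ := M.nonempty_colors
  let col : ∀ i, σ.S i → Fin C := fun i t => if h : ∃ γ, t ∈ T γ i then h.choose else γ₀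
  have hcol : ∀ i t, σ.src i t ≠ 0 → ∀ γ, col i t = γ ↔ t ∈ T γ i := by
    intro i t ht γ
    have h := hcover i t ht
    have hc : t ∈ T (col i t) i := by simpa only [col, h, dif_pos] using h.choose_spec
    exact ⟨fun e => e ▸ hc, fun hγ => hdisj i t ht _ _ hc hγ⟩
  refine ⟨col, fun i γ => ?_, fun j γ => σ.outputsIff_of_forall fun s hs => ?_⟩
  · rw [← hqp γ i, PMF.map_apply]
    refine tsum_congr fun t => ?_
    by_cases ht : σ.src i t = 0
    · simp [ht]
    · simp only [eq_comm (a := γ), hcol i t ht γ]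
      split_ifs <;> simp
  · have hE : (∀ i : N.SourceOf j, col i (s i) = γ) ↔ ∀ i, N.conn i j → s i ∈ T γ i := by
      simp only [Subtype.forall]
      exact forall_congr' fun i => forall_congr' fun _ => hcol i (s i) (hs i) γ
    rw [hE]
    exact hTf γ j s hs

variable {col : ∀ i, σ.S i → Fin C} (hcol : M.IsColoring σ col)

include hcol in
theorem IsColoring.exists_color_eq (i : I) (γ : Fin C) : ∃ t, σ.src i t ≠ 0 ∧ col i t = γ := by
  have h : γ ∈ ((σ.src i).map (col i)).support := by
    rw [PMF.mem_support_iff, hcol.1 i γ]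
    simpa using M.pcolor_pos γ
  obtain ⟨t, ht, h⟩ := (PMF.mem_support_map_iff _ _ _).1 h
  exact ⟨t, ht, h⟩

include hcol in
theorem IsColoring.resp_matchOut {j : J} {γ : Fin C} {s : ∀ i, σ.S i}
    (hs : ∀ i, σ.src i (s i) ≠ 0) (h : ∀ i, N.conn i j → col i (s i) = γ) :
    σ.resp j (fun i => s i) (M.matchOut j γ) = 1 :=
  (hcol.2 j γ (fun i => s i) fun i => hs i).1 fun i => h i i.2

include hcol in
open Classical in
theorem IsColoring.prodExp_color (c : I → Fin C) (j : J) :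
    prodExp σ.src (fun s => if ∀ i, N.conn i j → col i (s i) = c i then 1 else 0) =
      ∏ i with N.conn i j, ENNReal.ofReal (M.pcolor (c i)) := by
  refine (prodExp_congr fun s _ => ?_).trans ((prodExp_indicator (p := σ.src) (fun i => N.conn i j)
    fun i => {t | col i t = c i}).trans ?_)
  · by_cases h : ∀ i, N.conn i j → col i (s i) = c i
    · rw [if_pos h, if_pos (show ∀ i, N.conn i j → s i ∈ {t | col i t = c i} from h)]
    · rw [if_neg h, if_neg (show ¬ ∀ i, N.conn i j → s i ∈ {t | col i t = c i} from h)]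
  refine Finset.prod_congr rfl fun i _ => ?_
  rw [← hcol.1 i (c i), PMF.map_apply]
  refine tsum_congr fun t => ?_
  simp [eq_comm]

variable {j : J} {c : I → Fin C} {a : Out j} (ha : M.IsOutcome j (N.restrict c j) a)

include hσ hcol ha in
theorem outputsIff_of_color_eq (h : ∀ s : (∀ i, σ.S i), (∀ i, σ.src i (s i) ≠ 0) →
      σ.resp j (fun i => s i) a ≠ 0 → ∀ i, N.conn i j → col i (s i) = c i) :
    σ.OutputsIff j a fun s => ∀ i : N.SourceOf j, col i (s i) = N.restrict c j i := by
  classical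
  refine σ.outputsIff_of_resp_eq_ite (fun s hs => ?_)
  convert eq_of_prodExp_eq (p := σ.src) (f := fun s => σ.resp j (fun i => s i) a)
    (g := fun s => if ∀ i, N.conn i j → col i (s i) = c i then 1 else 0) (fun s hs => ?_)
    (ne_top_of_le_ne_top ENNReal.one_ne_top (prodExp_le_one fun s => PMF.coe_le_one _ _)) ?_ s hs
  · split_ifs with hc
    · exact PMF.coe_le_one _ _
    · exact (not_not.1 fun h0 => hc (h s hs h0)).le
  · rw [M.prodExp_resp_restrict hσ ha, hcol.prodExp_color]

include hσ hcol ha in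
theorem outputsIff_of_resp_eq_one (h : ∀ s : (∀ i, σ.S i), (∀ i, σ.src i (s i) ≠ 0) →
      (∀ i, N.conn i j → col i (s i) = c i) → σ.resp j (fun i => s i) a = 1) :
    σ.OutputsIff j a fun s => ∀ i : N.SourceOf j, col i (s i) = N.restrict c j i := by
  classical
  refine σ.outputsIff_of_resp_eq_ite (fun s hs => ?_)
  convert (eq_of_prodExp_eq (p := σ.src) (g := fun s => σ.resp j (fun i => s i) a)
    (f := fun s => if ∀ i, N.conn i j → col i (s i) = c i then 1 else 0) (fun s hs => ?_)
    (ne_top_of_le_ne_top ENNReal.one_ne_top (prodExp_le_one fun s => ?_)) ?_ s hs).symm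
  · split_ifs with hc
    · exact (h s hs hc).ge
    · exact zero_le
  · split_ifs <;> simp
  · rw [M.prodExp_resp_restrict hσ ha, hcol.prodExp_color]

theorem isRigid_of_forall_inBasis (hECS : N.IsECS) (hPFIS : N.AdmitsPFIS) {c : I → Fin C}
    (hc : ∀ j, M.InBasis j (N.restrict c j)) (j : J) : M.IsRigid j (N.restrict c j) := by
  classical
  refine ⟨hc j, fun σ hσ col hcol a ha => outputsIff_of_color_eq M hσ hcol ha ?_⟩
  intro s hs hne i hij
  by_contra hci
  choose b hb using hc
  obtain ⟨T, hT, hTf⟩ := M.exists_resp_eq_indicator hσ hECS hPFIS (c := c) (a := update b j a) (by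
    intro k
    by_cases hk : k = j
    · subst hk; simpa using ha
    · rw [update_of_ne hk]; exact hb k)
  have hsT : s i ∈ T i := by
    by_contra hsT
    refine hne ?_
    have := (hTf j s hs).2 fun h => hsT (h i hij)
    rwa [update_self] at this
  choose t₀ ht₀T ht₀ using hT
  choose u hu hucol using fun k => hcol.exists_color_eq M k (col i (s i))
  obtain ⟨j₁, j₂, hjj, hj₁, hj₂, huniq⟩ := hECS i
  let s' : ∀ k, σ.S k := update (fun k => if N.conn k j₁ then t₀ k else u k) i (s i)
  have hs' : ∀ k, σ.src k (s' k) ≠ 0 := fun k => by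
    by_cases hk : k = i
    · subst hk; simpa [s'] using hs k
    · simp only [s', update_of_ne hk]
      split_ifs; exacts [ht₀ k, hu k]
  have hout : M.IsOutcome j₁ (N.restrict c j₁) (update b j a j₁) := by
    by_cases hk : j₁ = j
    · subst hk; simpa using ha
    · rw [update_of_ne hk]; exact hb j₁
  have h := M.resp_mul_resp_matchOut_eq_zero hσ hjj hout hj₁ hj₂ (Ne.symm hci) s' hs'
  rw [(hTf j₁ s' hs').1 fun k hk => ?_, hcol.resp_matchOut M hs' fun k hk => ?_] at h
  · simp at h
  · by_cases hki : k = i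
    · subst hki; simp [s']
    · have : ¬ N.conn k j₁ := fun h => hki (huniq k h hk)
      simpa [s', update_of_ne hki, this] using hucol k
  · by_cases hki : k = i
    · subst hki; simpa [s'] using hsT
    · simpa [s', update_of_ne hki, hk] using ht₀T k

theorem isRigid_of_unique_common_source (hECS : N.IsECS) {j : J} {c : N.SourceOf j → Fin C}
    (hc : M.InBasis j c)
    (h : ∀ i : N.SourceOf j, ∃ j', N.conn i j' ∧ ∀ i', N.conn i' j → N.conn i' j' → i' = i) :
    M.IsRigid j c := by
  classical
  have := M.nonempty_colors
  obtain ⟨c, rfl⟩ := N.exists_restrict_eq c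
  refine ⟨hc, fun σ hσ col hcol a ha => outputsIff_of_color_eq M hσ hcol ha ?_⟩
  intro s hs hne i hij
  by_contra hci
  have hj' : ∃ j', j ≠ j' ∧ N.conn i j' ∧ ∀ i', N.conn i' j → N.conn i' j' → i' = i := by
    obtain ⟨j', hj', hu⟩ := h ⟨i, hij⟩
    by_cases hjj : j = j'
    · subst hjj
      obtain ⟨j₁, j₂, hne, h₁, h₂, -⟩ := hECS i
      by_cases h₁' : j = j₁
      · exact ⟨j₂, h₁' ▸ hne, h₂, fun i' hi' _ => hu i' hi' hi'⟩
      · exact ⟨j₁, h₁', h₁, fun i' hi' _ => hu i' hi' hi'⟩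
    · exact ⟨j', hjj, hj', hu⟩
  obtain ⟨j', hjj, hj', hu⟩ := hj'
  choose u hup hucol using fun k => hcol.exists_color_eq M k (col i (s i))
  let s' : ∀ k, σ.S k := fun k => if N.conn k j then s k else u k
  have hs' : ∀ k, σ.src k (s' k) ≠ 0 := fun k => by
    simp only [s']
    split_ifs; exacts [hs k, hup k]
  have hzero := M.resp_mul_resp_matchOut_eq_zero hσ hjj ha hij hj' (Ne.symm hci) s' hs'
  rw [hcol.resp_matchOut M hs' fun k hk => ?_, mul_one] at hzero
  · refine hne ?_
    rw [← hzero]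
    exact σ.dependsOn_resp j a fun k hk => by simp [s', show N.conn k j from hk]
  · by_cases hkj : N.conn k j
    · obtain rfl := hu k hkj hk
      simp [s', hkj]
    · simpa [s', hkj] using hucol k

theorem isRigid_of_cover {j : J} {c : I → Fin C} (hc : M.InBasis j (N.restrict c j))
    {L : Finset J} (hjL : j ∉ L) (hcov : ∀ i, N.conn i j → ∃ l ∈ L, N.conn i l)
    (hL : ∀ l ∈ L, M.IsRigid l (N.restrict c l)) : M.IsRigid j (N.restrict c j) := by
  classical
  refine ⟨hc, fun σ hσ col hcol a ha => outputsIff_of_resp_eq_one M hσ hcol ha ?_⟩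
  intro s hs hsc
  obtain ⟨γ⟩ := M.nonempty_colors
  let b : ∀ k, Out k :=
    update (fun l => if hl : l ∈ L then (hL l hl).1.choose else M.matchOut l γ) j a
  have hbj : b j = a := update_self ..
  have hbL : ∀ l ∈ L, M.IsOutcome l (N.restrict c l) (b l) := fun l hl => by
    have hlj : l ≠ j := fun h => hjL (h ▸ hl)
    simp only [b, update_of_ne hlj, hl, dif_pos]
    exact (hL l hl).1.choose_spec
  have hEL := M.prodExp_prod_resp_restrict hσ (K := L) hbL
  have hEjL := M.prodExp_prod_resp_restrict hσ (K := insert j L) (c := c) (a := b) (by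
    intro l hl
    rcases Finset.mem_insert.1 hl with rfl | hl
    · rwa [hbj]
    · exact hbL l hl)
  have hsrc : ∀ i, (∃ k ∈ insert j L, N.conn i k) ↔ ∃ k ∈ L, N.conn i k := fun i => by
    simp only [Finset.exists_mem_insert]
    exact ⟨fun h => h.elim (hcov i) id, Or.inr⟩
  simp only [hsrc] at hEjL
  choose u hup hucol using fun k => hcol.exists_color_eq M k (c k)
  let s' : ∀ k, σ.S k := fun k => if N.conn k j then s k else u k
  have hs' : ∀ k, σ.src k (s' k) ≠ 0 := fun k => by
    simp only [s']
    split_ifs; exacts [hs k, hup k]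
  have hs'c : ∀ k, col k (s' k) = c k := fun k => by
    simp only [s']
    split_ifs with hk
    exacts [hsc k hk, hucol k]
  have heq := eq_of_prodExp_eq (p := σ.src)
    (f := fun s => ∏ k ∈ insert j L, σ.resp k (fun i => s i) (b k))
    (g := fun s => ∏ k ∈ L, σ.resp k (fun i => s i) (b k))
    (fun s _ => by
      rw [Finset.prod_insert hjL]
      exact mul_le_of_le_one_left' (PMF.coe_le_one _ _))
    (ne_top_of_le_ne_top ENNReal.one_ne_top
      (prodExp_le_one fun s => Finset.prod_le_one' fun k _ => PMF.coe_le_one _ _))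
    (hEjL.trans hEL.symm) s' hs'
  have hone : ∏ k ∈ L, σ.resp k (fun i => s' i) (b k) = 1 := Finset.prod_eq_one fun l hl =>
    ((hL l hl).2 σ hσ col hcol (b l) (hbL l hl) (fun i => s' i) fun i => hs' i).1
      fun i => hs'c i
  rw [Finset.prod_insert hjL, hone, mul_one, hbj] at heq
  rw [← heq]
  exact σ.dependsOn_resp j a fun k hk => by simp [s', show N.conn k j from hk]

end QuantumStrategy.ColorMatching

end Rigidity

theorem corollary2 {I J : Type*} [Fintype I] [Fintype J] (N : Network I J)
    (hECS : N.IsECS) (hPFIS : N.AdmitsPFIS)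
    {Out : J → Type*} [∀ j, Fintype (Out j)] {κ : I → J → Type*} [∀ i j, Fintype (κ i j)]
    (Q : QuantumStrategy N Out κ) {C : ℕ} (M : Q.ColorMatching C) :
    -- every simulating classical strategy is Color-Matching, with the same color distribution
    (∀ σ : ClassicalStrategy N Out, Q.SimulatedBy σ →
      ∃ col : (∀ i, σ.S i → Fin C), M.IsColoring σ col) ∧
    -- all parties measure the vectors of a global assignment of colors
    (∀ c : I → Fin C, (∀ j, M.InBasis j (N.restrict c j)) →
      ∀ j, M.IsRigid j (N.restrict c j)) ∧
    -- each source of the party is her unique common source with some party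
    (∀ (j : J) (c : N.SourceOf j → Fin C), M.InBasis j c →
      (∀ i : N.SourceOf j, ∃ j', N.conn i j' ∧ ∀ i', N.conn i' j → N.conn i' j' → i' = i) →
      M.IsRigid j c) ∧
    -- the sources of the party are covered by other parties with rigid vectors
    (∀ (j : J) (c : I → Fin C), M.InBasis j (N.restrict c j) →
      ∀ L : Finset J, j ∉ L → (∀ i, N.conn i j → ∃ l ∈ L, N.conn i l) →
      (∀ l ∈ L, M.IsRigid l (N.restrict c l)) →
      M.IsRigid j (N.restrict c j)) := by
  exact ⟨fun σ hσ => M.exists_isColoring hσ hECS hPFIS,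
    fun c hc => M.isRigid_of_forall_inBasis hECS hPFIS hc,
    fun j c hc h => M.isRigid_of_unique_common_source hECS hc h,
    fun j c hc L hjL hcov hL => M.isRigid_of_cover hc hjL hcov hL⟩
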